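/- **Setting.** A *piecewise $C^2$ graph* $\Gamma\subset\mathbb R^3$ consists of finitely many points, its vertices, and finitely many simple arcs, its edges, each joining two vertices. Each edge is of class $C^2$ up to its endpoints with respect to arc length $s$. No edge contains a vertex in its interior, and distinct edges meet only in common endpoints. Several edges may join the same two vertices. For a vertex $q$ let $T_1,\dots,T_d$ be the unit tangent vectors at $q$ pointing into the $d=d(q)$ edges that end at $q$. Let $\chi_i:S^2\to\{-1,+1\}$ be $-1$ where $\langle e,T_i\rangle>0$ and $+1$ elsewhere. Put $$\mathrm{nc}(q)=\frac14\int_{S^2}\Big[\sum_{i=1}^d\chi_i(e)\Big]^+dA_{S^2}(e),\qquad \mathcal N(\Gamma)=\sum_{q\text{ a vertex}}\mathrm{nc}(q)+\sum_{\text{edges}}\int\Big|\frac{d^2x}{ds^2}\Big|\,ds,$$ where $[t]^+=\max(t,0)$. The number $\mathcal N(\Gamma)$ is the *net total curvature* of $\Gamma$. The *double* of $\Gamma$ has the same vertices and two copies of every edge. A *parameterization* $\Gamma'$ of the double is obtained by matching in pairs, at each vertex $q$, the $2d(q)$ ends of doubled edges at $q$, and gluing the doubled edges along this matching. This gives a compact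 one-dimensional manifold without boundary, not necessarily connected, with a map to $\mathbb R^3$ that covers each edge of the double once. For $e\in S^2$ and $q\in\Gamma$ let $\mathrm{lmax}(e,q)$ and $\mathrm{lmin}(e,q)$ be the numbers of points of $\Gamma'$ over $q$ at which the height function $\langle e,\cdot\rangle$ along $\Gamma'$ has a local maximum, respectively a local minimum. The number of *net local maxima* at $q$ is $\mathrm{nlm}(e,q)=\frac12[\mathrm{lmax}(e,q)-\mathrm{lmin}(e,q)]$. The *multiplicity* at $e$ is $$\mu(e)=\sum_q[\mathrm{nlm}(e,q)]^+,$$ the sum over all $q$ that are vertices of $\Gamma$ or critical points of $\langle e,\cdot\rangle$, that is, interior points of edges at which $\langle e,dx/ds\rangle=0$. **Theorem.** Let $\Gamma$ be a piecewise $C^2$ graph in $\mathbb R^3$ and let $\Gamma'$ be any parameterization of its double. Then for almost every $e\in S^2$ the height function $\langle e,\cdot\rangle$ has only finitely many critical points on $\Gamma$, so that $\mu(e)$ is a finite sum; the function $\mu$ is integrable on $S^2$; and $$\mathcal N(\Gamma)=\frac12\int_{S^2}\mu(e)\,dA_{S^2}(e).$$ -/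

import Mathlib

open Set MeasureTheory

noncomputable section

/-- Euclidean three-space. -/
abbrev R3 : Type := EuclideanSpace ℝ (Fin 3)

/-- The unit sphere of directions. -/
abbrev S2 : Type := Metric.sphere (0 : R3) 1

/-- Surface area on the unit sphere (total mass `4 * π`). -/
def sphereArea : Measure S2 := (volume : Measure R3).toSphere

/-- A piecewise `C²` graph embedded in `ℝ³`, with vertices indexed by `V` and edges by `E`
(both assumed finite wherever it matters).  Every edge is a simple arc, of class `C²` up to its
endpoints and given by its parameterization by arc length on `[0, len a]`; its endpoints are
vertices, and distinct edges meet only in common endpoints.  Several edges may join the same two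
vertices, and the graph need not be connected.  The ends of an edge are labelled by `Bool`:
`false` is the initial end (parameter `0`), `true` the final end (parameter `len a`). -/
structure PiecewiseC2Graph (V E : Type*) where
  pos : V → R3
  pos_injective : Function.Injective pos
  endVertex : E → Bool → V
  len : E → ℝ
  len_pos : ∀ a, 0 < len a
  curve : E → ℝ → R3
  contDiffOn_curve : ∀ a, ContDiffOn ℝ 2 (curve a) (Icc 0 (len a))
  unit_speed : ∀ a, ∀ s ∈ Icc 0 (len a), ‖derivWithin (curve a) (Icc 0 (len a)) s‖ = 1
  injOn_curve : ∀ a, InjOn (curve a) (Icc 0 (len a))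
  curve_zero : ∀ a, curve a 0 = pos (endVertex a false)
  curve_len : ∀ a, curve a (len a) = pos (endVertex a true)
  interior_ne_vertex : ∀ a, ∀ s ∈ Ioo 0 (len a), ∀ v, curve a s ≠ pos v
  interior_disjoint : ∀ a b, a ≠ b → ∀ s ∈ Ioo 0 (len a), ∀ t ∈ Ioo 0 (len b),
    curve a s ≠ curve b t

namespace PiecewiseC2Graph

variable {V E : Type*} (G : PiecewiseC2Graph V E)

/-- The velocity `dx/ds` along the edge `a` (one-sided at the endpoints). -/
def velocity (a : E) (s : ℝ) : R3 := derivWithin (G.curve a) (Icc 0 (G.len a)) s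

/-- The curvature vector `d²x/ds²` along the edge `a`. -/
def curvatureVector (a : E) (s : ℝ) : R3 :=
  iteratedDerivWithin 2 (G.curve a) (Icc 0 (G.len a)) s

/-- The unit tangent vector at an end of the edge `a`, pointing into the edge. -/
def endTangent (a : E) : Bool → R3
  | false => G.velocity a 0
  | true => -G.velocity a (G.len a)

/-- The function equal to `-1` on the open hemisphere centred at `T` and to `+1` elsewhere. -/
def hemisphereSign (T : R3) (e : S2) : ℝ := if 0 < inner ℝ (e : R3) T then -1 else 1

open Classical in
/-- The contribution `nc(v)` of a vertex: a quarter of the integral over the sphere of the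
positive part of the sum of the functions `χᵢ` of the edges (edge ends) at `v`. -/
def vertexNetCurvature [Fintype E] (v : V) : ℝ :=
  (1 / 4) * ∫ e : S2,
    max (∑ h : E × Bool with G.endVertex h.1 h.2 = v,
      hemisphereSign (G.endTangent h.1 h.2) e) 0 ∂sphereArea

/-- The net total curvature: vertex contributions plus the total curvature of the open edges. -/
def netTotalCurvature [Fintype V] [Fintype E] : ℝ :=
  ∑ v : V, G.vertexNetCurvature v + ∑ a : E, ∫ s in Ioo 0 (G.len a), ‖G.curvatureVector a s‖

/-- The two edge copies in the double of the graph, as a disjoint union of closed intervals: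
a point is an edge, one of the labels of its two copies, and an arc length parameter. -/
abbrev DoubledEdges : Type _ := Σ d : E × Bool, Icc (0 : ℝ) (G.len d.1)

/-- The endpoint of a doubled edge; `((a, i), b)` is the end `b` of the copy `i` of `a`. -/
def doubledEnd : (E × Bool) × Bool → G.DoubledEdges
  | (d, false) => ⟨d, 0, left_mem_Icc.2 (G.len_pos d.1).le⟩
  | (d, true) => ⟨d, G.len d.1, right_mem_Icc.2 (G.len_pos d.1).le⟩

/-- The obvious map from the doubled edges to space. -/
def doubledMap (x : G.DoubledEdges) : R3 := G.curve x.1.1 x.2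

theorem doubledMap_doubledEnd (h : (E × Bool) × Bool) :
    G.doubledMap (G.doubledEnd h) = G.pos (G.endVertex h.1.1 h.2) := by
  rcases h with ⟨d, _ | _⟩
  · exact G.curve_zero d.1
  · exact G.curve_len d.1

/-- A parameterization of the double of the graph by a compact one-dimensional manifold (without
boundary, not necessarily connected) covering each edge of the double once.  It is described by
how the doubled edges are glued end to end: at every vertex the ends of the doubled edges are
matched in pairs.  The manifold itself is `Parameterization.Domain`. -/
structure Parameterization where
  mate : (E × Bool) × Bool → (E × Bool) × Bool
  mate_involutive : Function.Involutive mate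
  mate_ne : ∀ h, mate h ≠ h
  endVertex_mate : ∀ h, G.endVertex (mate h).1.1 (mate h).2 = G.endVertex h.1.1 h.2

/-- Parameterizations exist: run along one copy of each edge and back along the other one. -/
instance : Nonempty G.Parameterization :=
  ⟨{ mate := fun h => ((h.1.1, !h.1.2), h.2)
     mate_involutive := fun h => by simp
     mate_ne := fun h hh => by
       have := congrArg (fun k => k.1.2) hh
       simp at this
     endVertex_mate := fun _ => rfl }⟩

namespace Parameterization

variable {G} (P : G.Parameterization)

/-- Each end of a doubled edge is glued to its mate. -/
def Glue (x y : G.DoubledEdges) : Prop :=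
  ∃ h, x = G.doubledEnd h ∧ y = G.doubledEnd (P.mate h)

/-- The parameterizing closed one-dimensional manifold, with the quotient topology. -/
def Domain : Type _ := Quot P.Glue

instance : TopologicalSpace P.Domain := inferInstanceAs (TopologicalSpace (Quot P.Glue))

/-- The parameterization itself, as a map into space. -/
def toSpace : P.Domain → R3 :=
  Quot.lift G.doubledMap (by
    rintro x y ⟨h, rfl, rfl⟩
    rw [doubledMap_doubledEnd, doubledMap_doubledEnd, P.endVertex_mate])

/-- The height function `⟨e, ·⟩` along the parameterization. -/
def height (e : S2) (x : P.Domain) : ℝ := inner ℝ (e : R3) (P.toSpace x)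

/-- The number of local maxima of the height at the points over `q`. -/
def lmax (e : S2) (q : R3) : ℕ := {x | P.toSpace x = q ∧ IsLocalMax (P.height e) x}.ncard

/-- The number of local minima of the height at the points over `q`. -/
def lmin (e : S2) (q : R3) : ℕ := {x | P.toSpace x = q ∧ IsLocalMin (P.height e) x}.ncard

/-- The number of net local maxima of the height at `q`, a half-integer. -/
def nlm (e : S2) (q : R3) : ℝ := (1 / 2) * ((P.lmax e q : ℝ) - (P.lmin e q : ℝ))

end Parameterization

/-- The points over which the multiplicity is summed: the vertices, and the critical points of
`⟨e, ·⟩` in the interiors of the edges. -/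
def criticalPoints (e : S2) : Set R3 :=
  range G.pos ∪
    {q | ∃ a, ∃ s ∈ Ioo 0 (G.len a), G.curve a s = q ∧ inner ℝ (e : R3) (G.velocity a s) = 0}

variable {G} in
/-- The multiplicity `μ(e)`.  It is the intended sum when there are finitely many vertices and
critical points, and arbitrary otherwise. -/
def Parameterization.multiplicity (P : G.Parameterization) (e : S2) : ℝ :=
  ∑ᶠ q ∈ G.criticalPoints e, max (P.nlm e q) 0

end PiecewiseC2Graph

end

open Filter Topology

noncomputable section

/-! The proof evaluates `μ(e)` for generic `e` and integrates the vertex and edge terms separately.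
A direction is generic when it is orthogonal to no end tangent and the heights along the edges have
only nondegenerate critical points; this excludes a null set (`ae_isGeneric`).

Vertices. Each point of `Γ'` over a vertex joins two ends of doubled edges. It is a local maximum
when both ends have `χ = +1`, a local minimum when both have `χ = -1`, and neither otherwise. So the
pair contributes the mean of its two signs to `lmax - lmin`. Summing over the pairs, the matching
drops out and `nlm = (1/2) ∑ χᵢ` (`nlm_vertex`). The two factors `1/2` make the `1/4` in `nc`.

Edges. An interior local maximum is covered by two points of `Γ'`, so there `nlm = 1`; at a minimum
`nlm ≤ 0` and the positive part removes it. Hence an edge contributes the number of zeros at which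
`⟨e, T⟩` decreases, `T` being the unit tangent. These are crossings, in one direction, of the great
circle orthogonal to `e` by the spherical curve `T`.

Crofton's formula (`lintegral_ncard_descents`) gives the integral of that number as twice the length
of `T`, that is `2 ∫ |x''|`. It is proved by discretization: for a short arc from `u` to `v`, the
directions positive at `u` and negative at `v` form a lune of area twice the angle
(`sphereArea_lune`). Sums of angles over fine partitions converge to the length, while the discrete
crossing counts are bounded by the true count and almost everywhere eventually equal to it. -/

theorem measurableSet_and {α : Type*} [MeasurableSpace α] {p q : α → Prop}
    (hp : MeasurableSet {x | p x}) (hq : MeasurableSet {x | q x}) :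
    MeasurableSet {x | p x ∧ q x} := by
  rw [ofPred_and]
  exact hp.inter hq

/-! ### Areas of bands and lunes on the sphere -/

/-- Coordinates with respect to an orthonormal basis, as an element of `ℝ × ℝ × ℝ`. -/
def frameCoords (b : OrthonormalBasis (Fin 3) ℝ R3) (x : R3) : ℝ × ℝ × ℝ :=
  (inner ℝ x (b 0), inner ℝ x (b 1), inner ℝ x (b 2))

theorem measurePreserving_frameCoords (b : OrthonormalBasis (Fin 3) ℝ R3) :
    MeasurePreserving (frameCoords b) volume volume := by
  have h1 := b.measurePreserving_repr
  have h2 := PiLp.volume_preserving_ofLp (Fin 3)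
  have h3 := volume_preserving_piFinSuccAbove (fun _ : Fin 3 => ℝ) 0
  have h4 := (MeasurePreserving.id (volume : Measure ℝ)).prod (volume_preserving_finTwoArrow ℝ)
  have h := h4.comp (h3.comp (h2.comp h1))
  have heq : frameCoords b = Prod.map id MeasurableEquiv.finTwoArrow ∘
      (MeasurableEquiv.piFinSuccAbove (fun _ : Fin 3 => ℝ) 0) ∘ WithLp.ofLp ∘ b.repr := by
    funext x
    simp [frameCoords, MeasurableEquiv.piFinSuccAbove, OrthonormalBasis.repr_apply_apply,
    MeasurableEquiv.finTwoArrow, Fin.insertNthEquiv, real_inner_comm]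
    exact ⟨(real_inner_comm _ _).trans (b.repr_apply_apply x 1).symm,
      (real_inner_comm _ _).trans (b.repr_apply_apply x 2).symm⟩
  rw [heq]
  exact h

theorem norm_sq_eq_frameCoords (b : OrthonormalBasis (Fin 3) ℝ R3) (x : R3) :
    ‖x‖ ^ 2 = (frameCoords b x).1 ^ 2 + ((frameCoords b x).2.1 ^ 2 + (frameCoords b x).2.2 ^ 2) := by
  rw [← b.sum_sq_norm_inner_left x]
  simp [frameCoords, Fin.sum_univ_three, add_assoc]

/-- The area of a region of directions cut out by a homogeneous condition on the coordinates. -/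
theorem sphereArea_setOf_frameCoords (b : OrthonormalBasis (Fin 3) ℝ R3) {Q : ℝ × ℝ × ℝ → Prop}
    (hQ : ∀ r : ℝ, 0 < r → ∀ y, Q (r • y) ↔ Q y) (hm : MeasurableSet {y | Q y}) :
    sphereArea {e : S2 | Q (frameCoords b (e : R3))} =
      3 * volume {y : ℝ × ℝ × ℝ | 0 < y.1 ^ 2 + (y.2.1 ^ 2 + y.2.2 ^ 2) ∧
        y.1 ^ 2 + (y.2.1 ^ 2 + y.2.2 ^ 2) < 1 ∧ Q y} := by
  have hmp := measurePreserving_frameCoords b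
  have hsm : ∀ (r : ℝ) (x : R3), frameCoords b (r • x) = r • frameCoords b x := by
    intro r x
    simp [frameCoords, real_inner_smul_left]
  -- `toSphere` assigns to a set `3` times the volume of the punctured cone over it in the unit
  -- ball; since `Q` is homogeneous, that cone is again cut out by `Q`.
  rw [sphereArea, Measure.toSphere_apply' _
    (show MeasurableSet {e : S2 | Q (frameCoords b (e : R3))} from
      (hmp.measurable.comp measurable_subtype_coe) hm)]
  have hset : MeasurableSet {y : ℝ × ℝ × ℝ | 0 < y.1 ^ 2 + (y.2.1 ^ 2 + y.2.2 ^ 2) ∧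
      y.1 ^ 2 + (y.2.1 ^ 2 + y.2.2 ^ 2) < 1 ∧ Q y} := by
    refine measurableSet_and ?_ (measurableSet_and ?_ hm)
    · exact measurableSet_lt (by fun_prop) (by fun_prop)
    · exact measurableSet_lt (by fun_prop) (by fun_prop)
  rw [← hmp.measure_preimage hset.nullMeasurableSet]
  congr 2
  · simp
  · ext x
    simp only [Set.mem_smul, mem_image, mem_ofPred_eq, mem_preimage, ← norm_sq_eq_frameCoords]
    constructor
    · rintro ⟨r, hr, _, ⟨e, he, rfl⟩, rfl⟩
      have hn : ‖r • (e : R3)‖ = r := by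
        rw [norm_smul, Real.norm_of_nonneg hr.1.le, norm_eq_of_mem_sphere, mul_one]
      rw [hn, hsm, hQ r hr.1]
      refine ⟨pow_pos hr.1 2, ?_, he⟩
      nlinarith [hr.1, hr.2]
    · rintro ⟨h0, h1, h2⟩
      have hpos : 0 < ‖x‖ := by
        rcases (norm_nonneg x).eq_or_lt with h | h
        · rw [← h] at h0; norm_num at h0
        · exact h
      have hx : ‖x‖⁻¹ • x ∈ Metric.sphere (0 : R3) 1 := by
        simp [norm_smul, hpos.ne']
      refine ⟨‖x‖, ⟨hpos, by nlinarith⟩, ‖x‖⁻¹ • x, ⟨⟨_, hx⟩, ?_, rfl⟩, ?_⟩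
      · change Q (frameCoords b (‖x‖⁻¹ • x))
        rw [hsm, hQ _ (inv_pos.2 hpos)]
        exact h2
      · change ‖x‖ • (‖x‖⁻¹ • x) = x
        rw [smul_smul, mul_inv_cancel₀ hpos.ne', one_smul]

theorem exists_orthonormalBasis_of_unit {u : R3} (hu : ‖u‖ = 1) :
    ∃ b : OrthonormalBasis (Fin 3) ℝ R3, b 0 = u := by
  have ho : Orthonormal ℝ (({0} : Set (Fin 3)).domRestrict fun _ => u) := by
    constructor
    · intro i; simpa using hu
    · intro i j hij
      exact absurd (Subtype.ext (i.2.trans j.2.symm)) hij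
  obtain ⟨b, hb⟩ := ho.exists_orthonormalBasis_extension_of_card_eq (by simp)
  exact ⟨b, hb 0 rfl⟩

theorem exists_orthonormalBasis_of_pair {u w : R3} (hu : ‖u‖ = 1) (hw : ‖w‖ = 1)
    (huw : inner ℝ u w = 0) :
    ∃ b : OrthonormalBasis (Fin 3) ℝ R3, b 1 = u ∧ b 2 = w := by
  have ho : Orthonormal ℝ (({1, 2} : Set (Fin 3)).domRestrict ![0, u, w]) := by
    constructor
    · rintro ⟨i, rfl | rfl⟩
      · simpa using hu
      · simpa using hw
    · rintro ⟨i, rfl | rfl⟩ ⟨j, rfl | rfl⟩ hij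
      · exact absurd rfl hij
      · simpa using huw
      · simpa [real_inner_comm] using huw
      · exact absurd rfl hij
  obtain ⟨b, hb⟩ := ho.exists_orthonormalBasis_extension_of_card_eq (by simp)
  exact ⟨b, by simpa using hb 1 (by simp), by simpa using hb 2 (by simp)⟩

instance : IsFiniteMeasure sphereArea := by
  unfold sphereArea; infer_instance

theorem measurable_inner_sphere (u : R3) : Measurable fun e : S2 => inner ℝ (e : R3) u := by
  fun_prop

/-- A band of half-width `δ` around a great circle has area `O(δ)`. -/
theorem sphereArea_band_le {u : R3} (hu : ‖u‖ = 1) {δ : ℝ} (hδ : 0 ≤ δ) :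
    sphereArea {e : S2 | |inner ℝ (e : R3) u| ≤ δ} ≤ ENNReal.ofReal (24 * δ) := by
  obtain ⟨b, rfl⟩ := exists_orthonormalBasis_of_unit hu
  have hsub : {e : S2 | |inner ℝ (e : R3) (b 0)| ≤ δ} ⊆
      {e : S2 | (fun y : ℝ × ℝ × ℝ => y.1 ^ 2 ≤ δ ^ 2 * (y.1 ^ 2 + (y.2.1 ^ 2 + y.2.2 ^ 2)))
        (frameCoords b (e : R3))} := by
    intro e he
    have h1 := norm_sq_eq_frameCoords b (e : R3)
    simp only [mem_ofPred_eq] at he ⊢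
    rw [← h1, norm_eq_of_mem_sphere]
    simpa [frameCoords] using sq_le_sq' (abs_le.1 he).1 (abs_le.1 he).2
  refine (measure_mono hsub).trans ?_
  rw [sphereArea_setOf_frameCoords b
    (Q := fun y => y.1 ^ 2 ≤ δ ^ 2 * (y.1 ^ 2 + (y.2.1 ^ 2 + y.2.2 ^ 2)))]
  · have hsub2 : {y : ℝ × ℝ × ℝ | 0 < y.1 ^ 2 + (y.2.1 ^ 2 + y.2.2 ^ 2) ∧
        y.1 ^ 2 + (y.2.1 ^ 2 + y.2.2 ^ 2) < 1 ∧
        y.1 ^ 2 ≤ δ ^ 2 * (y.1 ^ 2 + (y.2.1 ^ 2 + y.2.2 ^ 2))} ⊆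
        Icc (-δ) δ ×ˢ (Icc (-1) 1 ×ˢ Icc (-1) 1) := by
      rintro ⟨x, y, z⟩ ⟨-, h1, h2⟩
      simp only at h1 h2
      have hx : x ^ 2 ≤ δ ^ 2 := by nlinarith [sq_nonneg δ]
      refine ⟨abs_le.1 (abs_le_of_sq_le_sq hx hδ), abs_le.1 ?_, abs_le.1 ?_⟩
      · exact abs_le_of_sq_le_sq (by nlinarith [sq_nonneg x, sq_nonneg z]) zero_le_one
      · exact abs_le_of_sq_le_sq (by nlinarith [sq_nonneg x, sq_nonneg y]) zero_le_one
    -- The box has volume `2δ · 2 · 2`, and the factor `3` gives `24 δ`.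
    refine (mul_le_mul_right (measure_mono hsub2) 3).trans ?_
    rw [Measure.volume_eq_prod, Measure.prod_prod, Measure.volume_eq_prod, Measure.prod_prod,
      Real.volume_Icc, Real.volume_Icc, ← ENNReal.ofReal_mul (by norm_num),
      ← ENNReal.ofReal_mul (by linarith),
      show (3 : ENNReal) = ENNReal.ofReal 3 by simp, ← ENNReal.ofReal_mul (by norm_num)]
    apply ENNReal.ofReal_le_ofReal
    linarith
  · intro r hr y
    simp only [Prod.smul_fst, Prod.smul_snd, smul_eq_mul, mul_pow]
    have : 0 < r ^ 2 := by positivity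
    constructor <;> intro h
    · refine le_of_mul_le_mul_left ?_ this; linarith
    · have := mul_le_mul_of_nonneg_left h this.le; linarith
  · exact measurableSet_le (by fun_prop) (by fun_prop)

theorem sphereArea_orthogonal_eq_zero {u : R3} (hu : ‖u‖ = 1) :
    sphereArea {e : S2 | inner ℝ (e : R3) u = 0} = 0 := by
  refine le_antisymm ?_ zero_le
  have := sphereArea_band_le hu le_rfl
  simpa using this

theorem ae_inner_ne_zero {u : R3} (hu : ‖u‖ = 1) :
    ∀ᵐ e : S2 ∂sphereArea, inner ℝ (e : R3) u ≠ 0 := by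
  rw [ae_iff]
  simpa only [not_not] using sphereArea_orthogonal_eq_zero hu

/-- The mass of the pairs of height and radius in the unit half disc, for the weight `r`. -/
def halfDiscMass : ENNReal :=
  ∫⁻ p : ℝ × ℝ, {p : ℝ × ℝ | 0 < p.2 ∧ p.1 ^ 2 + p.2 ^ 2 < 1}.indicator
    (fun p => ENNReal.ofReal p.2) p

/-- The volume of the part of the unit ball over an angular sector is proportional to the angle. -/
theorem volume_angular_sector {S : Set ℝ} (hS : MeasurableSet S) {Q : ℝ × ℝ → Prop}
    (hQ : MeasurableSet {p | Q p})
    (h : ∀ r > 0, ∀ φ ∈ Ioo (-Real.pi) Real.pi,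
      Q (r * Real.cos φ, r * Real.sin φ) ↔ φ ∈ S) :
    volume {y : ℝ × ℝ × ℝ | 0 < y.1 ^ 2 + (y.2.1 ^ 2 + y.2.2 ^ 2) ∧
        y.1 ^ 2 + (y.2.1 ^ 2 + y.2.2 ^ 2) < 1 ∧ Q y.2} =
      halfDiscMass * volume (S ∩ Ioo (-Real.pi) Real.pi) := by
  have hset : MeasurableSet {y : ℝ × ℝ × ℝ | 0 < y.1 ^ 2 + (y.2.1 ^ 2 + y.2.2 ^ 2) ∧
      y.1 ^ 2 + (y.2.1 ^ 2 + y.2.2 ^ 2) < 1 ∧ Q y.2} := by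
    refine measurableSet_and ?_ (measurableSet_and ?_ (hQ.preimage measurable_snd))
    · exact measurableSet_lt (by fun_prop) (by fun_prop)
    · exact measurableSet_lt (by fun_prop) (by fun_prop)
  have hD : MeasurableSet {p : ℝ × ℝ | 0 < p.2 ∧ p.1 ^ 2 + p.2 ^ 2 < 1} :=
    measurableSet_and (measurableSet_lt (by fun_prop) (by fun_prop))
      (measurableSet_lt (by fun_prop) (by fun_prop))
  have hmeas : Measurable ({p : ℝ × ℝ | 0 < p.2 ∧ p.1 ^ 2 + p.2 ^ 2 < 1}.indicator
      (fun p => ENNReal.ofReal p.2)) :=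
    Measurable.indicator (by fun_prop) hD
  rw [Measure.volume_eq_prod, Measure.prod_apply hset, halfDiscMass, Measure.volume_eq_prod,
    lintegral_prod _ hmeas.aemeasurable, ← lintegral_mul_const _ hmeas.lintegral_prod_right']
  refine lintegral_congr fun z => ?_
  -- On the slice at height `z`, polar coordinates turn the integrand into a function of `(z, r)`,
  -- including the Jacobian `r`, times the indicator of the angles.
  rw [← lintegral_indicator_one (measurable_prodMk_left hset),
    ← Measure.volume_eq_prod, ← lintegral_comp_polarCoord_symm, polarCoord_target]
  have hA : MeasurableSet (S ∩ Ioo (-Real.pi) Real.pi) := hS.inter measurableSet_Ioo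
  rw [← lintegral_indicator (measurableSet_Ioi.prod measurableSet_Ioo),
    ← lintegral_indicator_one hA]
  rw [Measure.volume_eq_prod, ← lintegral_prod_mul
    (f := fun y => {p : ℝ × ℝ | 0 < p.2 ∧ p.1 ^ 2 + p.2 ^ 2 < 1}.indicator
      (fun p => ENNReal.ofReal p.2) (z, y))
    (hmeas.comp measurable_prodMk_left).aemeasurable
    (measurable_one.indicator hA).aemeasurable]
  refine lintegral_congr fun p => ?_
  obtain ⟨r, φ⟩ := p
  simp only [polarCoord_symm_apply]
  by_cases hr : 0 < r
  · by_cases hφ : φ ∈ Ioo (-Real.pi) Real.pi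
    · have hpos : 0 < z ^ 2 + r ^ 2 := by positivity
      have hc : z ^ 2 + ((r * Real.cos φ) ^ 2 + (r * Real.sin φ) ^ 2) = z ^ 2 + r ^ 2 := by
        linear_combination r ^ 2 * Real.sin_sq_add_cos_sq φ
      have hmem : ((r, φ) : ℝ × ℝ) ∈ Ioi (0 : ℝ) ×ˢ Ioo (-Real.pi) Real.pi := ⟨hr, hφ⟩
      rw [indicator_of_mem hmem]
      by_cases hz : z ^ 2 + r ^ 2 < 1
      · by_cases hs : φ ∈ S
        · simp [indicator, hc, hr, hz, hs, hφ.1, hφ.2, hpos, h r hr φ hφ]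
        · simp [indicator, hc, hr, hz, hs, hpos, h r hr φ hφ]
      · simp [indicator, hc, hz]
    · simp [indicator, hφ]
  · simp [indicator, hr]

/-- The constant is not integrated directly: the sector formula for the full angle `2π` is compared
with the total area `4π` of the sphere. -/
theorem three_mul_halfDiscMass : 3 * halfDiscMass = 2 := by
  have h1 := volume_angular_sector (S := univ) MeasurableSet.univ (Q := fun _ => True)
    MeasurableSet.univ (by simp)
  let b : OrthonormalBasis (Fin 3) ℝ R3 := EuclideanSpace.basisFun (Fin 3) ℝ
  have h2 := sphereArea_setOf_frameCoords b (Q := fun _ => True) (by simp) MeasurableSet.univ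
  rw [h1, ofPred_true, sphereArea, Measure.toSphere_apply_univ,
    EuclideanSpace.volume_ball_fin_three] at h2
  have hpi := Real.pi_pos
  rw [univ_inter, Real.volume_Ioo, ← mul_assoc] at h2
  have h0 : ENNReal.ofReal (Real.pi - -Real.pi) ≠ 0 := by
    rw [Ne, ENNReal.ofReal_eq_zero]; linarith
  refine (ENNReal.mul_left_inj h0 ENNReal.ofReal_ne_top).1 ?_
  rw [mul_assoc, ← h2]
  simp only [finrank_euclideanSpace, Fintype.card_fin, ENNReal.ofReal_one, one_pow, mul_one]
  rw [show ((3 : ℕ) : ENNReal) = ENNReal.ofReal 3 by simp, ← ENNReal.ofReal_mul (by norm_num),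
    show (2 : ENNReal) = ENNReal.ofReal 2 by simp, ← ENNReal.ofReal_mul (by norm_num)]
  congr 1
  ring

/-- The lune of directions that are positive on `u` and negative on `v` has area twice the angle
between `u` and `v`. -/
theorem sphereArea_lune {u v : R3} (hu : ‖u‖ = 1) (hv : ‖v‖ = 1) (huv : v ≠ -u) :
    sphereArea {e : S2 | 0 < inner ℝ (e : R3) u ∧ inner ℝ (e : R3) v < 0} =
      ENNReal.ofReal (2 * InnerProductGeometry.angle u v) := by
  by_cases heq : u = v
  · subst heq
    rw [InnerProductGeometry.angle_self (by rintro rfl; simp at hu)]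
    have : {e : S2 | 0 < inner ℝ (e : R3) u ∧ inner ℝ (e : R3) u < 0} = ∅ := by
      ext e; simp; intro h; exact h.le
    rw [this]; simp
  set θ := InnerProductGeometry.angle u v with hθ
  have hcos : inner ℝ u v = Real.cos θ := by
    rw [hθ, InnerProductGeometry.cos_angle, hu, hv]; simp
  have hθ0 : 0 < θ := by
    refine (InnerProductGeometry.angle_nonneg u v).lt_of_ne fun h => heq ?_
    rw [← inner_eq_one_iff_of_norm_eq_one (𝕜 := ℝ) hu hv, hcos, hθ, ← h, Real.cos_zero] 
  have hθπ : θ < Real.pi := by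
    refine (InnerProductGeometry.angle_le_pi u v).lt_of_ne fun h => huv ?_
    have : inner ℝ (-u) v = 1 := by
      rw [inner_neg_left, hcos, hθ, h, Real.cos_pi]; simp
    exact ((inner_eq_one_iff_of_norm_eq_one (𝕜 := ℝ) (by simpa using hu) hv).1 this).symm
  have hsin : 0 < Real.sin θ := Real.sin_pos_of_pos_of_lt_pi hθ0 hθπ
  -- Gram–Schmidt in the plane of `u` and `v`: there `u` has polar angle `0` and `v` has polar angle
  -- `θ`.
  set w : R3 := (Real.sin θ)⁻¹ • (v - Real.cos θ • u) with hw
  have huw : inner ℝ u w = 0 := by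
    rw [hw, inner_smul_right, inner_sub_right, inner_smul_right, hcos,
      real_inner_self_eq_norm_sq, hu]
    ring
  have hvw : v = Real.cos θ • u + Real.sin θ • w := by
    rw [hw, smul_smul, mul_inv_cancel₀ hsin.ne', one_smul]; abel
  have hwn : ‖w‖ = 1 := by
    have h1 : ‖v‖ ^ 2 = (Real.cos θ) ^ 2 + (Real.sin θ) ^ 2 * ‖w‖ ^ 2 := by
      conv_lhs => rw [hvw]
      rw [norm_add_sq_real, norm_smul, norm_smul, inner_smul_left, inner_smul_right, huw, hu,
        mul_pow, mul_pow, Real.norm_eq_abs, Real.norm_eq_abs, sq_abs, sq_abs]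
      ring
    rw [hv] at h1
    have h2 : ‖w‖ ^ 2 = 1 := by
      have := Real.sin_sq_add_cos_sq θ
      have hs2 : 0 < Real.sin θ ^ 2 := by positivity
      refine mul_left_cancel₀ hs2.ne' ?_
      linarith
    exact (pow_eq_one_iff_of_nonneg (norm_nonneg w) two_ne_zero).1 h2
  obtain ⟨b, hb1, hb2⟩ := exists_orthonormalBasis_of_pair hu hwn huw
  have key := sphereArea_setOf_frameCoords b
    (Q := fun y => 0 < y.2.1 ∧ Real.cos θ * y.2.1 + Real.sin θ * y.2.2 < 0) ?_ ?_
  · have hset : {e : S2 | 0 < inner ℝ (e : R3) u ∧ inner ℝ (e : R3) v < 0} =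
        {e : S2 | (fun y : ℝ × ℝ × ℝ => 0 < y.2.1 ∧
          Real.cos θ * y.2.1 + Real.sin θ * y.2.2 < 0) (frameCoords b (e : R3))} := by
      ext e
      simp only [mem_ofPred_eq, frameCoords, hb1, hb2]
      conv_lhs => rw [hvw]
      rw [inner_add_right, inner_smul_right, inner_smul_right]
    -- The conditions are `cos φ > 0` and `cos (φ - θ) < 0`; on `(-π, π)` they hold exactly on an
    -- interval of length `θ`.
    rw [hset, key, volume_angular_sector (S := Ioo (-(Real.pi / 2)) (θ - Real.pi / 2))
      measurableSet_Ioo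
      (Q := fun p => 0 < p.1 ∧ Real.cos θ * p.1 + Real.sin θ * p.2 < 0), ← mul_assoc,
      three_mul_halfDiscMass, inter_eq_left.2, Real.volume_Ioo,
      ENNReal.ofReal_mul zero_le_two]
    · simp
    · intro φ hφ
      constructor <;> linarith [hφ.1, hφ.2]
    · exact measurableSet_and (measurableSet_lt (by fun_prop) (by fun_prop))
        (measurableSet_lt (by fun_prop) (by fun_prop))
    · intro r hr φ hφ
      have e1 : Real.cos θ * (r * Real.cos φ) + Real.sin θ * (r * Real.sin φ) =
          r * Real.cos (φ - θ) := by rw [Real.cos_sub]; ring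
      simp only [e1, mul_pos_iff_of_pos_left, mul_neg_iff, hr, hr.not_gt, true_and, false_and, or_false]
      constructor
      · rintro ⟨h1, h2⟩
        have hφ1 : -(Real.pi / 2) < φ := by
          by_contra hc
          have := Real.cos_nonpos_of_pi_div_two_le_of_le (x := -φ) (by linarith)
            (by linarith [hφ.1])
          rw [Real.cos_neg] at this
          linarith
        refine ⟨hφ1, ?_⟩
        by_contra hc
        have hφ2 : φ < Real.pi / 2 := by
          by_contra hc
          have := Real.cos_nonpos_of_pi_div_two_le_of_le (x := φ) (by linarith)
            (by linarith [hφ.2])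
          linarith
        have := Real.cos_nonneg_of_neg_pi_div_two_le_of_le (x := φ - θ) (by linarith)
          (by linarith)
        linarith
      · rintro ⟨h1, h2⟩
        refine ⟨Real.cos_pos_of_mem_Ioo ⟨h1, (by linarith : φ < Real.pi / 2)⟩, ?_⟩
        rw [← Real.cos_neg]
        exact Real.cos_neg_of_pi_div_two_lt_of_lt (by linarith) (by linarith)
  · intro r hr y
    simp only [Prod.smul_fst, Prod.smul_snd, smul_eq_mul]
    rw [show Real.cos θ * (r * y.2.1) + Real.sin θ * (r * y.2.2) =
      r * (Real.cos θ * y.2.1 + Real.sin θ * y.2.2) by ring]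
    simp only [mul_pos_iff_of_pos_left hr, mul_neg_iff, hr, hr.not_gt, true_and, false_and, or_false]
  · exact measurableSet_and (measurableSet_lt (by fun_prop) (by fun_prop))
        (measurableSet_lt (by fun_prop) (by fun_prop))

/-! ### Zeros of functions on an interval -/

section Zeros

variable {f f' : ℝ → ℝ} {L : ℝ}

/-- Infinitely many zeros would accumulate in the compact interval at a point that is a zero by
continuity, yet a nonzero derivative isolates a zero. -/
theorem finite_zeros_of_simple (hf : ∀ s ∈ Icc 0 L, HasDerivWithinAt f (f' s) (Icc 0 L) s)
    (hs : ∀ s ∈ Icc 0 L, f s = 0 → f' s ≠ 0) : {s ∈ Icc 0 L | f s = 0}.Finite := by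
  by_contra hinf
  have hinf : {s ∈ Icc 0 L | f s = 0}.Infinite := hinf
  obtain ⟨x, hx, hacc⟩ := hinf.exists_accPt_of_subset_isCompact isCompact_Icc (fun s hs => hs.1)
  rw [accPt_iff_frequently_nhdsNE] at hacc
  have hfx : f x = 0 := by
    by_contra hne
    have h1 : ∀ᶠ y in 𝓝[Icc 0 L] x, f y ≠ 0 :=
      (hf x hx).continuousWithinAt.eventually_ne hne
    rw [eventually_nhdsWithin_iff] at h1
    exact hacc ((h1.filter_mono nhdsWithin_le_nhds).mono fun y hy hmem => hy hmem.1 hmem.2)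
  have h2 := (hf x hx).eventually_ne (c := 0) (hs x hx hfx)
  rw [eventually_nhdsWithin_iff] at h2
  have h3 : ∀ᶠ y in 𝓝[≠] x, y ≠ x := eventually_mem_nhdsWithin
  exact hacc (((h2.filter_mono nhdsWithin_le_nhds).and h3).mono
    fun y hy hmem => hy.1 ⟨hmem.1, hy.2⟩ hmem.2)

/-- Just after a point where the derivative is negative the function is smaller. -/
theorem eventually_lt_right_of_deriv_neg {D : Set ℝ} {x d : ℝ} (h : HasDerivWithinAt f d D x)
    (hd : d < 0) : ∀ᶠ y in 𝓝[D] x, x < y → f y < f x := by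
  have h1 : ∀ᶠ y in 𝓝[D \ {x}] x, slope f x y < 0 :=
    (hasDerivWithinAt_iff_tendsto_slope.1 h).eventually_lt_const hd
  rw [eventually_nhdsWithin_iff] at h1 ⊢
  filter_upwards [h1] with y hy hyD hxy
  have := hy ⟨hyD, hxy.ne'⟩
  rw [slope_def_field, div_neg_iff] at this
  rcases this with h | h <;> linarith [h.1, h.2]

theorem eventually_gt_left_of_deriv_neg {D : Set ℝ} {x d : ℝ} (h : HasDerivWithinAt f d D x)
    (hd : d < 0) : ∀ᶠ y in 𝓝[D] x, y < x → f x < f y := by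
  have h1 : ∀ᶠ y in 𝓝[D \ {x}] x, slope f x y < 0 :=
    (hasDerivWithinAt_iff_tendsto_slope.1 h).eventually_lt_const hd
  rw [eventually_nhdsWithin_iff] at h1 ⊢
  filter_upwards [h1] with y hy hyD hxy
  have := hy ⟨hyD, hxy.ne⟩
  rw [slope_def_field, div_neg_iff] at this
  rcases this with h | h <;> linarith [h.1, h.2]

/-- The last zero in `[a, b]` works: `f` is negative after it, so the derivative there cannot be
positive, and it is nonzero by simplicity. -/
theorem exists_descent (hf : ∀ s ∈ Icc 0 L, HasDerivWithinAt f (f' s) (Icc 0 L) s)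
    (hs : ∀ s ∈ Icc 0 L, f s = 0 → f' s ≠ 0) {a b : ℝ} (ha : 0 ≤ a) (hab : a ≤ b) (hb : b ≤ L)
    (hfa : 0 < f a) (hfb : f b < 0) : ∃ z ∈ Ioo a b, f z = 0 ∧ f' z < 0 := by
  have hsub : Icc a b ⊆ Icc 0 L := Icc_subset_Icc ha hb
  have hcont : ContinuousOn f (Icc a b) := fun s hs =>
    ((hf s (hsub hs)).continuousWithinAt).mono hsub
  have hcl : IsCompact (Icc a b ∩ f ⁻¹' {0}) :=
    isCompact_Icc.of_isClosed_subset
      (hcont.preimage_isClosed_of_isClosed isClosed_Icc isClosed_singleton) inter_subset_left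
  obtain ⟨y, hy, hy0⟩ := intermediate_value_Icc' hab hcont ⟨hfb.le, hfa.le⟩
  obtain ⟨z, ⟨hz, hz0⟩, hmax⟩ := hcl.exists_isGreatest ⟨y, hy, hy0⟩
  have hz0 : f z = 0 := hz0
  have hza : z ≠ a := by rintro rfl; linarith
  have hzb : z ≠ b := by rintro rfl; linarith
  have hzb' : z < b := lt_of_le_of_ne hz.2 hzb
  refine ⟨z, ⟨lt_of_le_of_ne hz.1 hza.symm, hzb'⟩, hz0, ?_⟩
  have hneg : ∀ t ∈ Ioc z b, f t < 0 := by
    intro t ht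
    by_contra hc
    obtain ⟨w, hw, hw0⟩ := intermediate_value_Icc' ht.2
      (hcont.mono (Icc_subset_Icc (hz.1.trans ht.1.le) le_rfl)) ⟨hfb.le, not_lt.1 hc⟩
    have := hmax ⟨⟨(hz.1.trans ht.1.le).trans hw.1, hw.2⟩, hw0⟩
    linarith [hw.1, ht.1]
  refine lt_of_le_of_ne ?_ (hs z (hsub hz) hz0)
  by_contra hc
  have hder : HasDerivWithinAt (fun s => -f s) (-f' z) (Ioo z b) z :=
    ((hf z (hsub hz)).mono ((Ioo_subset_Icc_self.trans
      (Icc_subset_Icc hz.1 le_rfl)).trans hsub)).neg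
  have hev := eventually_lt_right_of_deriv_neg hder (by linarith)
  have : (𝓝[Ioo z b] z).NeBot := by
    rw [nhdsWithin_Ioo_eq_nhdsGT hzb']; infer_instance
  obtain ⟨t, ht1, ht2⟩ := (hev.and eventually_mem_nhdsWithin).exists
  have := ht1 ht2.1
  have := hneg t ⟨ht2.1, ht2.2.le⟩
  linarith

theorem exists_sign_change (hf : ∀ s ∈ Icc 0 L, HasDerivWithinAt f (f' s) (Icc 0 L) s)
    {z : ℝ} (hz : z ∈ Ioo 0 L) (hz0 : f z = 0) (hz' : f' z < 0) :
    ∃ ε > 0, (∀ s ∈ Ioo (z - ε) z, 0 < f s) ∧ ∀ s ∈ Ioo z (z + ε), f s < 0 := by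
  have hder := (hf z (Ioo_subset_Icc_self hz)).hasDerivAt (Icc_mem_nhds hz.1 hz.2)
  rw [← hasDerivWithinAt_univ] at hder
  have h1 := (eventually_lt_right_of_deriv_neg hder hz').and
    (eventually_gt_left_of_deriv_neg hder hz')
  rw [nhdsWithin_univ, Metric.eventually_nhds_iff] at h1
  obtain ⟨ε, hε, h⟩ := h1
  refine ⟨ε, hε, fun s hs => ?_, fun s hs => ?_⟩
  · have := (h (y := s) (by rw [Real.dist_eq, abs_lt]; constructor <;> linarith [hs.1, hs.2])).2 hs.2
    rwa [hz0] at this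
  · have := (h (y := s) (by rw [Real.dist_eq, abs_lt]; constructor <;> linarith [hs.1, hs.2])).1 hs.1
    rwa [hz0] at this

theorem exists_mem_partition_interval {p : ℕ → ℝ} {n : ℕ} (hn : 0 < n) {s : ℝ} (h0 : p 0 ≤ s)
    (h1 : s ≤ p n) : ∃ i < n, p i ≤ s ∧ s ≤ p (i + 1) := by
  induction n with
  | zero => exact absurd hn (lt_irrefl 0)
  | succ n ih =>
    rcases Nat.eq_zero_or_pos n with rfl | hn'
    · exact ⟨0, one_pos, h0, h1⟩
    · rcases le_total s (p n) with h | h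
      · obtain ⟨i, hi, hh⟩ := ih hn' h
        exact ⟨i, by omega, hh⟩
      · exact ⟨n, by omega, h, h1⟩

/-- The `i`-th point of the partition of `[0, L]` into `n` equal parts. -/
def node (L : ℝ) (n i : ℕ) : ℝ := i * (L / n)

theorem node_zero (L : ℝ) (n : ℕ) : node L n 0 = 0 := by simp [node]

theorem node_self (L : ℝ) {n : ℕ} (hn : 0 < n) : node L n n = L := by
  have : (n : ℝ) ≠ 0 := by positivity
  rw [node]; field_simp

theorem node_succ (L : ℝ) (n i : ℕ) : node L n (i + 1) = node L n i + L / n := by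
  simp only [node]; push_cast; ring

theorem node_mono (hL : 0 ≤ L) (n : ℕ) : Monotone (node L n) := by
  refine monotone_nat_of_le_succ fun i => ?_
  rw [node_succ]
  have : 0 ≤ L / n := by positivity
  linarith

theorem node_mem (hL : 0 ≤ L) {n i : ℕ} (hi : i ≤ n) : node L n i ∈ Icc 0 L := by
  rcases Nat.eq_zero_or_pos n with rfl | hn
  -- For `n = 0` the convention `L / 0 = 0` puts the only node at `0`.
  · simp [node, hL]
  · refine ⟨?_, ?_⟩
    · rw [← node_zero L n]; exact node_mono hL n (Nat.zero_le i)
    · conv_rhs => rw [← node_self L hn]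
      exact node_mono hL n hi

/-- The number of intervals of the uniform partition over which `f` passes from positive to
negative values. -/
def downCrossings (f : ℝ → ℝ) (L : ℝ) (n : ℕ) : ℕ :=
  ((Finset.range n).filter fun i => 0 < f (node L n i) ∧ f (node L n (i + 1)) < 0).card

/-- The interior zeros with negative derivative. -/
def descents (f f' : ℝ → ℝ) (L : ℝ) : Set ℝ := {s ∈ Ioo 0 L | f s = 0 ∧ f' s < 0}

theorem finite_descents (hf : ∀ s ∈ Icc 0 L, HasDerivWithinAt f (f' s) (Icc 0 L) s)
    (hs : ∀ s ∈ Icc 0 L, f s = 0 → f' s ≠ 0) : (descents f f' L).Finite :=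
  (finite_zeros_of_simple hf hs).subset fun _ h => ⟨Ioo_subset_Icc_self h.1, h.2.1⟩

/-- Each interval of down-crossing contains a descent in its interior, and these interiors are
disjoint. Finiteness of the descents matters, because `ncard` is `0` on infinite sets. -/
theorem downCrossings_le (hL : 0 ≤ L)
    (hf : ∀ s ∈ Icc 0 L, HasDerivWithinAt f (f' s) (Icc 0 L) s)
    (hs : ∀ s ∈ Icc 0 L, f s = 0 → f' s ≠ 0) (n : ℕ) :
    downCrossings f L n ≤ (descents f f' L).ncard := by
  have hfin := finite_descents hf hs
  have hex : ∀ i : ℕ, ∃ z : ℝ, (i < n ∧ 0 < f (node L n i) ∧ f (node L n (i + 1)) < 0) →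
      z ∈ Ioo (node L n i) (node L n (i + 1)) ∧ f z = 0 ∧ f' z < 0 := by
    intro i
    by_cases h : i < n ∧ 0 < f (node L n i) ∧ f (node L n (i + 1)) < 0
    · obtain ⟨z, hz, hz'⟩ := exists_descent hf hs (node_mem hL h.1.le).1
        (node_mono hL n (Nat.le_succ i)) (node_mem hL h.1).2 h.2.1 h.2.2
      exact ⟨z, fun _ => ⟨hz, hz'⟩⟩
    · exact ⟨0, fun h' => absurd h' h⟩
  choose z hz using hex
  rw [ncard_eq_toFinset_card _ hfin, downCrossings]
  refine Finset.card_le_card_of_injOn z ?_ ?_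
  · intro i hi
    simp only [Finset.coe_filter, Finset.mem_range, mem_ofPred_eq] at hi
    obtain ⟨h1, h2⟩ := hz i hi
    simp only [Finset.mem_coe, Finite.mem_toFinset]
    exact ⟨⟨(node_mem hL hi.1.le).1.trans_lt h1.1, h1.2.trans_le (node_mem hL hi.1).2⟩, h2⟩
  · intro i hi j hj hij
    simp only [Finset.coe_filter, Finset.mem_range, mem_ofPred_eq] at hi hj
    have h1 := (hz i hi).1
    have h2 := (hz j hj).1
    rw [hij] at h1
    by_contra hne
    rcases lt_or_gt_of_ne hne with h | h
    · have := node_mono hL n (Nat.succ_le_of_lt h)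
      simp only [Nat.succ_eq_add_one] at this
      linarith [h1.2, h2.1]
    · have := node_mono hL n (Nat.succ_le_of_lt h)
      simp only [Nat.succ_eq_add_one] at this
      linarith [h2.2, h1.1]

/-- Once the mesh is smaller than the radius on which `f` has a fixed sign on each side of every
descent, the interval around a descent is a down-crossing and contains no second descent. As `f`
vanishes at no node, descents lie inside intervals. -/
theorem eventually_downCrossings_eq (hL : 0 < L)
    (hf : ∀ s ∈ Icc 0 L, HasDerivWithinAt f (f' s) (Icc 0 L) s)
    (hs : ∀ s ∈ Icc 0 L, f s = 0 → f' s ≠ 0) (hne : ∀ n, ∀ i ≤ n, f (node L n i) ≠ 0) :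
    ∀ᶠ n in atTop, downCrossings f L n = (descents f f' L).ncard := by
  have hfin := finite_descents hf hs
  have h1 : ∀ᶠ n : ℕ in atTop, ∀ z ∈ descents f f' L, ∃ ε, L / n < ε ∧
      (∀ s ∈ Ioo (z - ε) z, 0 < f s) ∧ ∀ s ∈ Ioo z (z + ε), f s < 0 := by
    rw [eventually_all_finite hfin]
    intro z hz
    obtain ⟨ε, hε, h⟩ := exists_sign_change hf hz.1 hz.2.1 hz.2.2
    filter_upwards [(tendsto_const_div_atTop_nhds_zero_nat L).eventually_lt_const hε] with n hn
    exact ⟨ε, hn, h⟩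
  filter_upwards [h1, eventually_gt_atTop 0] with n hn hn0
  refine le_antisymm (downCrossings_le hL.le hf hs n) ?_
  have hex : ∀ z : ℝ, ∃ i : ℕ, z ∈ descents f f' L → i < n ∧
      z ∈ Ioo (node L n i) (node L n (i + 1)) := by
    intro z
    by_cases hz : z ∈ descents f f' L
    · obtain ⟨i, hi, h1, h2⟩ := exists_mem_partition_interval (p := node L n) hn0 (s := z)
        (by rw [node_zero]; exact hz.1.1.le) (by rw [node_self L hn0]; exact hz.1.2.le)
      refine ⟨i, fun _ => ⟨hi, lt_of_le_of_ne h1 ?_, lt_of_le_of_ne h2 ?_⟩⟩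
      · intro h; exact hne n i hi.le (h ▸ hz.2.1)
      · intro h; exact hne n (i + 1) hi (h ▸ hz.2.1)
    · exact ⟨0, fun h => absurd h hz⟩
  choose i hi using hex
  rw [ncard_eq_toFinset_card _ hfin, downCrossings]
  refine Finset.card_le_card_of_injOn i ?_ ?_
  · intro z hz
    simp only [Finset.mem_coe, Finite.mem_toFinset] at hz
    obtain ⟨h1, h2⟩ := hi z hz
    obtain ⟨ε, h3, h4, h5⟩ := hn z hz
    simp only [Finset.coe_filter, Finset.mem_range, mem_ofPred_eq]
    rw [node_succ] at h2 ⊢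
    exact ⟨h1, h4 _ ⟨by linarith [h2.2], h2.1⟩, h5 _ ⟨h2.2, by linarith [h2.1]⟩⟩
  · have key : ∀ z ∈ descents f f' L, ∀ w ∈ descents f f' L, i z = i w → ¬ z < w := by
      intro z hz w hw hzw hlt
      obtain ⟨-, h2⟩ := hi z hz
      obtain ⟨-, h2'⟩ := hi w hw
      obtain ⟨ε, h3, -, h5⟩ := hn z hz
      rw [← hzw] at h2'
      rw [node_succ] at h2 h2'
      have := h5 w ⟨hlt, by linarith [h2'.2, h2.1]⟩
      linarith [hw.2.1]
    intro z hz w hw hzw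
    simp only [Finset.mem_coe, Finite.mem_toFinset] at hz hw
    exact le_antisymm (not_lt.1 (key w hw z hz hzw.symm)) (not_lt.1 (key z hz w hw hzw))

end Zeros

/-! ### Angles and chords -/

theorem norm_sub_eq_two_mul_sin {u v : R3} (hu : ‖u‖ = 1) (hv : ‖v‖ = 1) :
    ‖u - v‖ = 2 * Real.sin (InnerProductGeometry.angle u v / 2) := by
  set θ := InnerProductGeometry.angle u v with hθ
  have hcos : inner ℝ u v = Real.cos θ := by
    rw [hθ, InnerProductGeometry.cos_angle, hu, hv]; simp
  have h0 := InnerProductGeometry.angle_nonneg u v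
  have hp := InnerProductGeometry.angle_le_pi u v
  have hsin : 0 ≤ Real.sin (θ / 2) :=
    Real.sin_nonneg_of_nonneg_of_le_pi (by linarith) (by linarith)
  refine (pow_left_inj₀ (norm_nonneg _) (by positivity) two_ne_zero).1 ?_
  rw [norm_sub_sq_real, hu, hv, hcos, mul_pow, Real.sin_sq_eq_half_sub,
    mul_div_cancel₀ _ two_ne_zero]
  ring

theorem norm_sub_le_angle {u v : R3} (hu : ‖u‖ = 1) (hv : ‖v‖ = 1) :
    ‖u - v‖ ≤ InnerProductGeometry.angle u v := by
  rw [norm_sub_eq_two_mul_sin hu hv]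
  have := Real.sin_le (x := InnerProductGeometry.angle u v / 2)
    (by linarith [InnerProductGeometry.angle_nonneg u v])
  linarith

/-- With `x` half the angle, the chord is `2 sin x`. Jordan's inequality gives `x ≤ ‖u - v‖`, and
`sin x ≥ x - x ^ 3 / 6` leaves a cubic error, negligible when summed over a fine partition. -/
theorem angle_le_norm_sub_add {u v : R3} (hu : ‖u‖ = 1) (hv : ‖v‖ = 1) :
    InnerProductGeometry.angle u v ≤ ‖u - v‖ + ‖u - v‖ ^ 3 := by
  have h := norm_sub_eq_two_mul_sin hu hv
  set x := InnerProductGeometry.angle u v / 2 with hx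
  have hx0 : 0 ≤ x := by linarith [InnerProductGeometry.angle_nonneg u v]
  have hxp : x ≤ Real.pi / 2 := by linarith [InnerProductGeometry.angle_le_pi u v]
  have h1 := Real.mul_le_sin hx0 hxp
  have hpi := Real.pi_lt_four
  have hpi0 := Real.pi_pos
  have h2 : x ≤ ‖u - v‖ := by
    rw [h]
    have : x = Real.pi / 2 * (2 / Real.pi * x) := by field_simp
    have h3 : 0 ≤ Real.sin x := Real.sin_nonneg_of_nonneg_of_le_pi hx0 (by linarith)
    calc x = Real.pi / 2 * (2 / Real.pi * x) := this
      _ ≤ Real.pi / 2 * Real.sin x := by gcongr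
      _ ≤ 2 * Real.sin x := by gcongr; linarith
  have h4 : x - x ^ 3 / 6 ≤ Real.sin x := by
    rcases hx0.eq_or_lt with h | h
    · rw [← h]; simp
    · exact (Real.sin_gt_sub_cube h).le
  have h5 : x ^ 3 ≤ ‖u - v‖ ^ 3 := by gcongr
  have h6 : 0 ≤ x ^ 3 := by positivity
  have : InnerProductGeometry.angle u v = 2 * x := by rw [hx]; ring
  linarith

/-! ### The Crofton formula for curves on the sphere -/

section Crofton

variable {T T' : ℝ → R3} {L : ℝ}

/-- Uniform continuity of `T'`, then the mean value inequality for `x ↦ T x - (x - s) • T' s`. -/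
theorem exists_uniform_taylor (hT : ∀ s ∈ Icc 0 L, HasDerivWithinAt T (T' s) (Icc 0 L) s)
    (hc : ContinuousOn T' (Icc 0 L)) {ε : ℝ} (hε : 0 < ε) :
    ∃ δ > 0, ∀ s ∈ Icc 0 L, ∀ t ∈ Icc 0 L, |t - s| < δ →
      ‖T' t - T' s‖ ≤ ε ∧ ‖T t - T s - (t - s) • T' s‖ ≤ ε * |t - s| := by
  have huc := isCompact_Icc.uniformContinuousOn_of_continuous hc
  rw [Metric.uniformContinuousOn_iff] at huc
  obtain ⟨δ, hδ, h⟩ := huc ε hε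
  have h1 : ∀ s ∈ Icc 0 L, ∀ t ∈ Icc 0 L, |t - s| < δ → ‖T' t - T' s‖ ≤ ε := by
    intro s hs t ht hst
    have := h t ht s hs (by rwa [Real.dist_eq])
    rw [dist_eq_norm] at this
    exact this.le
  refine ⟨δ, hδ, fun s hs t ht hst => ⟨h1 s hs t ht hst, ?_⟩⟩
  have hsub : uIcc s t ⊆ Icc 0 L := uIcc_subset_Icc hs ht
  have := (convex_uIcc s t).norm_image_sub_le_of_norm_hasDerivWithin_le
    (f := fun x => T x - (x - s) • T' s) (f' := fun x => T' x - T' s) (C := ε) (x := s) (y := t)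
    ?_ ?_ left_mem_uIcc right_mem_uIcc
  · simp only [sub_self, zero_smul, sub_zero, Real.norm_eq_abs] at this
    rwa [sub_right_comm]
  · intro x hx
    have h2 := ((hT x (hsub hx)).mono hsub).sub
      (((hasDerivWithinAt_id x (uIcc s t)).sub_const s).smul_const (T' s))
    rw [one_smul] at h2
    exact h2
  · intro x hx
    refine h1 s hs x (hsub hx) (lt_of_le_of_lt ?_ hst)
    exact abs_sub_left_of_mem_uIcc hx

theorem hasDerivWithinAt_height (hT : ∀ s ∈ Icc 0 L, HasDerivWithinAt T (T' s) (Icc 0 L) s)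
    (e : R3) : ∀ s ∈ Icc 0 L,
      HasDerivWithinAt (fun s => inner ℝ e (T s)) (inner ℝ e (T' s)) (Icc 0 L) s := by
  intro s hs
  have := (hasDerivWithinAt_const s (Icc 0 L) e).inner ℝ (hT s hs)
  simpa using this

/-- For almost every direction, the zeros of the height along a `C¹` spherical curve are simple. -/
theorem ae_simple_zeros (hL : 0 < L) (hT : ∀ s ∈ Icc 0 L, HasDerivWithinAt T (T' s) (Icc 0 L) s)
    (hc : ContinuousOn T' (Icc 0 L)) (h1 : ∀ s ∈ Icc 0 L, ‖T s‖ = 1) :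
    ∀ᵐ e : S2 ∂sphereArea, ∀ s ∈ Icc 0 L,
      inner ℝ (e : R3) (T s) = 0 → inner ℝ (e : R3) (T' s) ≠ 0 := by
  rw [ae_iff]
  set B := {e : S2 | ¬ ∀ s ∈ Icc 0 L,
      inner ℝ (e : R3) (T s) = 0 → inner ℝ (e : R3) (T' s) ≠ 0} with hB
  have key : ∀ ε > 0, sphereArea B ≤ ENNReal.ofReal (24 * L * ε) := by
    intro ε hε
    obtain ⟨δ, hδ, h⟩ := exists_uniform_taylor hT hc hε
    obtain ⟨n, hn, hn0⟩ := (((tendsto_const_div_atTop_nhds_zero_nat L).eventually_lt_const hδ).and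
      (eventually_gt_atTop 0)).exists
    -- At a degenerate zero both the value and the linear Taylor term vanish, so at a node within `L
    -- / n` the height is at most `ε * (L / n)`. The `n` bands have total area at most `24 L ε`, and
    -- `ε` is arbitrary.
    have hsub : B ⊆ ⋃ i ∈ Finset.range n,
        {e : S2 | |inner ℝ (e : R3) (T (node L n i))| ≤ ε * (L / n)} := by
      intro e he
      rw [hB, mem_ofPred_eq] at he
      push Not at he
      obtain ⟨s, hs, hs0, hs1⟩ := he
      obtain ⟨i, hi, hi1, hi2⟩ := exists_mem_partition_interval (p := node L n) hn0 (s := s)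
        (by rw [node_zero]; exact hs.1) (by rw [node_self L hn0]; exact hs.2)
      rw [node_succ] at hi2
      simp only [mem_iUnion, Finset.mem_range]
      refine ⟨i, hi, ?_⟩
      have habs : |node L n i - s| ≤ L / n := by rw [abs_le]; constructor <;> linarith
      have h2 := (h s hs (node L n i) (node_mem hL.le hi.le) (habs.trans_lt hn)).2
      have h3 : inner ℝ (e : R3) (T (node L n i)) = inner ℝ (e : R3)
          (T (node L n i) - T s - (node L n i - s) • T' s) := by
        rw [inner_sub_right, inner_sub_right, inner_smul_right, hs0, hs1]; ring
      rw [mem_ofPred_eq, h3]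
      refine (abs_real_inner_le_norm _ _).trans ?_
      rw [norm_eq_of_mem_sphere, one_mul]
      exact h2.trans (by gcongr)
    refine (measure_mono hsub).trans ((measure_biUnion_finset_le _ _).trans ?_)
    have hb : ∀ i ∈ Finset.range n,
        sphereArea {e : S2 | |inner ℝ (e : R3) (T (node L n i))| ≤ ε * (L / n)} ≤
        ENNReal.ofReal (24 * (ε * (L / n))) := fun i hi =>
      sphereArea_band_le (h1 _ (node_mem hL.le (Finset.mem_range.1 hi).le)) (by positivity)
    refine (Finset.sum_le_sum hb).trans ?_
    rw [Finset.sum_const, Finset.card_range, nsmul_eq_mul, ← ENNReal.ofReal_natCast,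
      ← ENNReal.ofReal_mul (by positivity)]
    apply ENNReal.ofReal_le_ofReal
    have : (n : ℝ) ≠ 0 := by positivity
    field_simp
    rfl
  refine le_antisymm ?_ zero_le
  have hlim : Tendsto (fun ε : ℝ => ENNReal.ofReal (24 * L * ε)) (𝓝[>] 0) (𝓝 0) := by
    have : Tendsto (fun ε : ℝ => ENNReal.ofReal (24 * L * ε)) (𝓝 0)
        (𝓝 (ENNReal.ofReal (24 * L * 0))) :=
      (ENNReal.continuous_ofReal.comp (by fun_prop)).tendsto 0
    rw [mul_zero, ENNReal.ofReal_zero] at this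
    exact this.mono_left nhdsWithin_le_nhds
  exact ge_of_tendsto hlim (eventually_mem_nhdsWithin.mono fun ε hε => key ε hε)

/-- Angle and arc length are both compared with `(L / n) * ‖T' a‖`, where `a` is the left node.
Consecutive points must not be antipodal for the lune formula to apply. -/
theorem eventually_angle_close (hL : 0 < L)
    (hT : ∀ s ∈ Icc 0 L, HasDerivWithinAt T (T' s) (Icc 0 L) s)
    (hc : ContinuousOn T' (Icc 0 L)) (h1 : ∀ s ∈ Icc 0 L, ‖T s‖ = 1) {ε : ℝ} (hε : 0 < ε)
    (hε1 : ε ≤ 1) :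
    ∀ᶠ n : ℕ in atTop, ∀ i < n, T (node L n (i + 1)) ≠ -T (node L n i) ∧
      |InnerProductGeometry.angle (T (node L n i)) (T (node L n (i + 1))) -
        ∫ s in node L n i..node L n (i + 1), ‖T' s‖| ≤ 3 * ε * (L / n) := by
  obtain ⟨δ, hδ, h⟩ := exists_uniform_taylor hT hc hε
  obtain ⟨K, hK⟩ := isCompact_Icc.exists_bound_of_continuousOn hc
  have hK0 : 0 ≤ K := (norm_nonneg _).trans (hK 0 ⟨le_rfl, hL.le⟩)
  have hlim := tendsto_const_div_atTop_nhds_zero_nat L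
  -- A chord is at most `(K + 1) * (L / n)`. The first limit makes its cube at most `ε * (L / n)`;
  -- the second makes the chord shorter than `1`, whereas antipodal points are at distance `2`.
  have hlim2 : Tendsto (fun n : ℕ => (K + 1) ^ 3 * (L / n) ^ 2) atTop (𝓝 0) := by
    simpa using (hlim.pow 2).const_mul ((K + 1) ^ 3)
  have hlim3 : Tendsto (fun n : ℕ => (K + 1) * (L / n)) atTop (𝓝 0) := by
    simpa using hlim.const_mul (K + 1)
  filter_upwards [hlim.eventually_lt_const hδ, hlim2.eventually_lt_const hε,
    hlim3.eventually_lt_const zero_lt_one, eventually_gt_atTop 0] with n hn hn2 hn3 hn0 i hi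
  set a := node L n i with ha
  set η := L / n with hη
  have hηpos : 0 < η := by positivity
  have hb : node L n (i + 1) = a + η := node_succ L n i
  have haI : a ∈ Icc 0 L := node_mem hL.le hi.le
  have hbI : a + η ∈ Icc 0 L := hb ▸ node_mem hL.le hi
  rw [hb]
  have habs : |a + η - a| = η := by rw [add_sub_cancel_left, abs_of_pos hηpos]
  obtain ⟨-, htay⟩ := h a haI (a + η) hbI (by rw [habs]; exact hn)
  rw [habs, add_sub_cancel_left] at htay
  have hchord : |‖T a - T (a + η)‖ - η * ‖T' a‖| ≤ ε * η := by
    have e1 : η * ‖T' a‖ = ‖η • T' a‖ := by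
      rw [norm_smul, Real.norm_of_nonneg hηpos.le]
    rw [e1, norm_sub_rev]
    exact (abs_norm_sub_norm_le _ _).trans htay
  have hKa := hK a haI
  have hchord2 : ‖T a - T (a + η)‖ ≤ (K + 1) * η := by
    have := (abs_le.1 hchord).2
    nlinarith
  have hcn := norm_nonneg (T a - T (a + η))
  have hcube : ‖T a - T (a + η)‖ ^ 3 ≤ ε * η := by
    calc ‖T a - T (a + η)‖ ^ 3 ≤ ((K + 1) * η) ^ 3 := by gcongr
      _ = (K + 1) ^ 3 * η ^ 2 * η := by ring
      _ ≤ ε * η := by gcongr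
  have hsub : Icc a (a + η) ⊆ Icc 0 L := Icc_subset_Icc haI.1 hbI.2
  have hint : |(∫ s in a..a + η, ‖T' s‖) - η * ‖T' a‖| ≤ ε * η := by
    have hii : IntervalIntegrable (fun s => ‖T' s‖) volume a (a + η) := by
      apply ContinuousOn.intervalIntegrable
      rw [uIcc_of_le (by linarith)]
      exact (hc.mono hsub).norm
    have e1 : (∫ s in a..a + η, ‖T' s‖) - η * ‖T' a‖ = ∫ s in a..a + η, (‖T' s‖ - ‖T' a‖) := by
      rw [intervalIntegral.integral_sub hii (by simp), intervalIntegral.integral_const,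
        add_sub_cancel_left, smul_eq_mul]
    rw [e1]
    have := intervalIntegral.norm_integral_le_of_norm_le_const (a := a) (b := a + η) (C := ε)
      (f := fun s => ‖T' s‖ - ‖T' a‖) ?_
    · rwa [habs, Real.norm_eq_abs] at this
    · intro s hs
      rw [uIoc_of_le (by linarith)] at hs
      refine (abs_norm_sub_norm_le _ _).trans (h a haI s (hsub ⟨hs.1.le, hs.2⟩) ?_).1
      rw [abs_lt]; constructor <;> linarith [hs.1, hs.2]
  refine ⟨fun heq => ?_, ?_⟩
  · rw [heq, sub_neg_eq_add, ← two_smul ℝ, norm_smul, h1 a haI] at hchord2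
    norm_num at hchord2
    linarith
  -- Three errors of size `ε * (L / n)`: chord against derivative, angle against chord, and integral
  -- against derivative.
  · have l1 := norm_sub_le_angle (h1 a haI) (h1 _ hbI)
    have l2 := angle_le_norm_sub_add (h1 a haI) (h1 _ hbI)
    rw [abs_le] at *
    constructor <;> linarith [hchord.1, hchord.2, hint.1, hint.2]

theorem tendsto_sum_angle (hL : 0 < L)
    (hT : ∀ s ∈ Icc 0 L, HasDerivWithinAt T (T' s) (Icc 0 L) s)
    (hc : ContinuousOn T' (Icc 0 L)) (h1 : ∀ s ∈ Icc 0 L, ‖T s‖ = 1) :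
    Tendsto (fun n : ℕ => ∑ i ∈ Finset.range n,
      InnerProductGeometry.angle (T (node L n i)) (T (node L n (i + 1)))) atTop
      (𝓝 (∫ s in Ioo 0 L, ‖T' s‖)) := by
  rw [Metric.tendsto_nhds]
  intro ε' hε'
  obtain ⟨ε, hε, hε1, hεL⟩ : ∃ ε > 0, ε ≤ 1 ∧ 3 * ε * L < ε' := by
    refine ⟨min 1 (ε' / (4 * L)), by positivity, min_le_left _ _, ?_⟩
    calc 3 * min 1 (ε' / (4 * L)) * L ≤ 3 * (ε' / (4 * L)) * L := by
          gcongr; exact min_le_right _ _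
      _ = 3 / 4 * ε' := by field_simp
      _ < ε' := by linarith
  filter_upwards [eventually_angle_close hL hT hc h1 hε hε1, eventually_gt_atTop 0] with n hn hn0
  have e1 : ∫ s in Ioo 0 L, ‖T' s‖ =
      ∑ i ∈ Finset.range n, ∫ s in node L n i..node L n (i + 1), ‖T' s‖ := by
    rw [intervalIntegral.sum_integral_adjacent_intervals, node_zero, node_self L hn0,
      intervalIntegral.integral_of_le hL.le, integral_Ioc_eq_integral_Ioo]
    intro k hk
    apply ContinuousOn.intervalIntegrable
    exact hc.norm.mono (uIcc_subset_Icc (node_mem hL.le hk.le) (node_mem hL.le hk))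
  rw [e1, Real.dist_eq, ← Finset.sum_sub_distrib]
  calc _ ≤ ∑ i ∈ Finset.range n, 3 * ε * (L / n) :=
        (Finset.abs_sum_le_sum_abs _ _).trans
          (Finset.sum_le_sum fun i hi => (hn i (Finset.mem_range.1 hi)).2)
    _ = 3 * ε * L := by
        have : (n : ℝ) ≠ 0 := by positivity
        rw [Finset.sum_const, Finset.card_range, nsmul_eq_mul]; field_simp
    _ < ε' := hεL

theorem measurableSet_lune (u v : R3) :
    MeasurableSet {e : S2 | 0 < inner ℝ (e : R3) u ∧ inner ℝ (e : R3) v < 0} :=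
  measurableSet_and (measurableSet_lt measurable_const (measurable_inner_sphere u))
    (measurableSet_lt (measurable_inner_sphere v) measurable_const)

theorem downCrossings_eq_sum_indicator (T : ℝ → R3) (L : ℝ) (n : ℕ) (e : S2) :
    (downCrossings (fun s => inner ℝ (e : R3) (T s)) L n : ENNReal) =
      ∑ i ∈ Finset.range n, {e : S2 | 0 < inner ℝ (e : R3) (T (node L n i)) ∧
        inner ℝ (e : R3) (T (node L n (i + 1))) < 0}.indicator 1 e := by
  rw [downCrossings, Finset.card_filter]
  push_cast
  refine Finset.sum_congr rfl fun i _ => ?_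
  simp [indicator]

theorem measurable_downCrossings (T : ℝ → R3) (L : ℝ) (n : ℕ) :
    Measurable fun e : S2 => (downCrossings (fun s => inner ℝ (e : R3) (T s)) L n : ENNReal) := by
  simp only [downCrossings_eq_sum_indicator]
  exact Finset.measurable_sum _ fun i _ => measurable_one.indicator (measurableSet_lune _ _)

theorem lintegral_downCrossings (T : ℝ → R3) (L : ℝ) (n : ℕ) :
    ∫⁻ e : S2, downCrossings (fun s => inner ℝ (e : R3) (T s)) L n ∂sphereArea =
      ∑ i ∈ Finset.range n, sphereArea {e : S2 | 0 < inner ℝ (e : R3) (T (node L n i)) ∧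
        inner ℝ (e : R3) (T (node L n (i + 1))) < 0} := by
  simp only [downCrossings_eq_sum_indicator]
  rw [lintegral_finsetSum _ fun i _ => measurable_one.indicator (measurableSet_lune _ _)]
  exact Finset.sum_congr rfl fun i _ => lintegral_indicator_one (measurableSet_lune _ _)

theorem tendsto_lintegral_downCrossings (hL : 0 < L)
    (hT : ∀ s ∈ Icc 0 L, HasDerivWithinAt T (T' s) (Icc 0 L) s)
    (hc : ContinuousOn T' (Icc 0 L)) (h1 : ∀ s ∈ Icc 0 L, ‖T s‖ = 1) :
    Tendsto (fun n => ∫⁻ e : S2, downCrossings (fun s => inner ℝ (e : R3) (T s)) L n ∂sphereArea)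
      atTop (𝓝 (ENNReal.ofReal (2 * ∫ s in Ioo 0 L, ‖T' s‖))) := by
  have hlim := ENNReal.tendsto_ofReal ((tendsto_sum_angle hL hT hc h1).const_mul 2)
  refine hlim.congr' ?_
  -- Only the absence of antipodal neighbours is used here, so `ε = 1` suffices.
  filter_upwards [eventually_angle_close hL hT hc h1 one_pos le_rfl] with n hn
  rw [lintegral_downCrossings, Finset.mul_sum, ENNReal.ofReal_sum_of_nonneg]
  · refine Finset.sum_congr rfl fun i hi => ?_
    have hi := Finset.mem_range.1 hi
    rw [sphereArea_lune (h1 _ (node_mem hL.le hi.le)) (h1 _ (node_mem hL.le hi)) (hn i hi).1]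
  · exact fun i _ => mul_nonneg zero_le_two (InnerProductGeometry.angle_nonneg _ _)

theorem ae_eventually_downCrossings_eq (hL : 0 < L)
    (hT : ∀ s ∈ Icc 0 L, HasDerivWithinAt T (T' s) (Icc 0 L) s)
    (hc : ContinuousOn T' (Icc 0 L)) (h1 : ∀ s ∈ Icc 0 L, ‖T s‖ = 1) :
    ∀ᵐ e : S2 ∂sphereArea, ∀ᶠ n in atTop,
      downCrossings (fun s => inner ℝ (e : R3) (T s)) L n =
        (descents (fun s => inner ℝ (e : R3) (T s)) (fun s => inner ℝ (e : R3) (T' s)) L).ncard := by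
  -- All partitions together have countably many nodes, each excluding a null great circle.
  have hne : ∀ᵐ e : S2 ∂sphereArea, ∀ n, ∀ i ≤ n, inner ℝ (e : R3) (T (node L n i)) ≠ 0 := by
    rw [ae_all_iff]; intro n
    rw [ae_all_iff]; intro i
    by_cases hi : i ≤ n
    · filter_upwards [ae_inner_ne_zero (h1 _ (node_mem hL.le hi))] with e he _ using he
    · exact Eventually.of_forall fun e h => absurd h hi
  filter_upwards [ae_simple_zeros hL hT hc h1, hne] with e he1 he2
  exact eventually_downCrossings_eq hL (hasDerivWithinAt_height hT e) he1 he2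

theorem aemeasurable_ncard_descents (hL : 0 < L)
    (hT : ∀ s ∈ Icc 0 L, HasDerivWithinAt T (T' s) (Icc 0 L) s)
    (hc : ContinuousOn T' (Icc 0 L)) (h1 : ∀ s ∈ Icc 0 L, ‖T s‖ = 1) :
    AEMeasurable (fun e : S2 => ((descents (fun s => inner ℝ (e : R3) (T s))
      (fun s => inner ℝ (e : R3) (T' s)) L).ncard : ENNReal)) sphereArea := by
  refine aemeasurable_of_tendsto_metrizable_ae atTop
    (fun n => (measurable_downCrossings T L n).aemeasurable) ?_
  filter_upwards [ae_eventually_downCrossings_eq hL hT hc h1] with e he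
  exact tendsto_const_nhds.congr' (he.mono fun n hn => by simp only [hn])

/-- Crofton's formula: the average number of descents through the equator orthogonal to `e` is
proportional to the length of the spherical curve. -/
theorem lintegral_ncard_descents (hL : 0 < L)
    (hT : ∀ s ∈ Icc 0 L, HasDerivWithinAt T (T' s) (Icc 0 L) s)
    (hc : ContinuousOn T' (Icc 0 L)) (h1 : ∀ s ∈ Icc 0 L, ‖T s‖ = 1) :
    ∫⁻ e : S2, (descents (fun s => inner ℝ (e : R3) (T s))
      (fun s => inner ℝ (e : R3) (T' s)) L).ncard ∂sphereArea =
      ENNReal.ofReal (2 * ∫ s in Ioo 0 L, ‖T' s‖) := by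
  have hlim := tendsto_lintegral_downCrossings hL hT hc h1
  -- Fatou's lemma gives `≤`. For `≥`, every discrete count is at most the number of descents.
  refine le_antisymm ?_ (le_of_tendsto' hlim fun n => lintegral_mono_ae ?_)
  · rw [← hlim.liminf_eq]
    refine le_trans (le_of_eq (lintegral_congr_ae ?_))
      (lintegral_liminf_le fun n => measurable_downCrossings T L n)
    filter_upwards [ae_eventually_downCrossings_eq hL hT hc h1] with e he
    exact (tendsto_const_nhds.congr' (he.mono fun n hn => by rw [hn])).liminf_eq.symm
  · filter_upwards [ae_simple_zeros hL hT hc h1] with e he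
    exact_mod_cast downCrossings_le hL.le (hasDerivWithinAt_height hT e) he n

theorem integrable_ncard_descents (hL : 0 < L)
    (hT : ∀ s ∈ Icc 0 L, HasDerivWithinAt T (T' s) (Icc 0 L) s)
    (hc : ContinuousOn T' (Icc 0 L)) (h1 : ∀ s ∈ Icc 0 L, ‖T s‖ = 1) :
    Integrable (fun e : S2 => ((descents (fun s => inner ℝ (e : R3) (T s))
      (fun s => inner ℝ (e : R3) (T' s)) L).ncard : ℝ)) sphereArea := by
  have := integrable_toReal_of_lintegral_ne_top (aemeasurable_ncard_descents hL hT hc h1)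
    (by rw [lintegral_ncard_descents hL hT hc h1]; exact ENNReal.ofReal_ne_top)
  simpa using this

theorem integral_ncard_descents (hL : 0 < L)
    (hT : ∀ s ∈ Icc 0 L, HasDerivWithinAt T (T' s) (Icc 0 L) s)
    (hc : ContinuousOn T' (Icc 0 L)) (h1 : ∀ s ∈ Icc 0 L, ‖T s‖ = 1) :
    ∫ e : S2, ((descents (fun s => inner ℝ (e : R3) (T s))
      (fun s => inner ℝ (e : R3) (T' s)) L).ncard : ℝ) ∂sphereArea =
      2 * ∫ s in Ioo 0 L, ‖T' s‖ := by
  have := integral_toReal (aemeasurable_ncard_descents hL hT hc h1)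
    (Eventually.of_forall fun e => ENNReal.natCast_lt_top _)
  rw [lintegral_ncard_descents hL hT hc h1, ENNReal.toReal_ofReal
    (mul_nonneg zero_le_two (integral_nonneg fun s => norm_nonneg _))] at this
  simpa using this

end Crofton

/-! ### Strict local extrema on an interval -/

theorem eventually_lt_isLocalMaxOn {g : ℝ → ℝ} {D : Set ℝ} {s : ℝ}
    (h : ∀ᶠ t in 𝓝[D] s, t ≠ s → g t < g s) : IsLocalMaxOn g D s := by
  filter_upwards [h] with t ht
  by_cases hts : t = s
  · rw [hts]
  · exact (ht hts).le

theorem eventually_lt_not_isLocalMinOn {g : ℝ → ℝ} {L s : ℝ} (hL : 0 < L) (hs : s ∈ Icc 0 L)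
    (h : ∀ᶠ t in 𝓝[Icc 0 L] s, t ≠ s → g t < g s) : ¬ IsLocalMinOn g (Icc 0 L) s := by
  intro hmin
  have hne : (𝓝[Icc 0 L \ {s}] s).NeBot :=
    accPt_principal_iff_nhdsWithin.1 (uniqueDiffWithinAt_iff_accPt.1 (uniqueDiffOn_Icc hL s hs))
  have h1 : ∀ᶠ t in 𝓝[Icc 0 L \ {s}] s, g t < g s ∧ g s ≤ g t := by
    have h2 : ∀ᶠ t in 𝓝[Icc 0 L \ {s}] s, g s ≤ g t := hmin.filter_mono (nhdsWithin_mono _ sdiff_subset)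
    filter_upwards [h.filter_mono (nhdsWithin_mono _ sdiff_subset), eventually_mem_nhdsWithin, h2]
      with t ht1 ht2 ht3
    exact ⟨ht1 ht2.2, ht3⟩
  obtain ⟨t, ht⟩ := h1.exists
  linarith [ht.1, ht.2]

/-- The second derivative test, in strict form. -/
theorem eventually_lt_of_second_deriv_neg {g f f' : ℝ → ℝ} {L z : ℝ}
    (hg : ∀ s ∈ Icc 0 L, HasDerivWithinAt g (f s) (Icc 0 L) s)
    (hf : ∀ s ∈ Icc 0 L, HasDerivWithinAt f (f' s) (Icc 0 L) s) (hz : z ∈ Ioo 0 L)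
    (hz0 : f z = 0) (hz' : f' z < 0) : ∀ᶠ t in 𝓝[Icc 0 L] z, t ≠ z → g t < g z := by
  obtain ⟨ε, hε, h1, h2⟩ := exists_sign_change hf hz hz0 hz'
  have hmv : ∀ a b, 0 ≤ a → a < b → b ≤ L → ∃ c ∈ Ioo a b, f c = (g b - g a) / (b - a) := by
    intro a b ha hab hb
    refine exists_hasDerivAt_eq_slope g f hab (fun x hx => ?_) fun x hx => ?_
    · exact (hg x ⟨ha.trans hx.1, hx.2.trans hb⟩).continuousWithinAt.mono (Icc_subset_Icc ha hb)
    · have hx1 := ha.trans_lt hx.1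
      have hx2 := hx.2.trans_le hb
      exact (hg x ⟨hx1.le, hx2.le⟩).hasDerivAt (Icc_mem_nhds hx1 hx2)
  have hev : ∀ᶠ t in 𝓝[Icc 0 L] z, t ∈ Ioo (z - ε) (z + ε) :=
    nhdsWithin_le_nhds (Ioo_mem_nhds (by linarith) (by linarith))
  filter_upwards [hev, eventually_mem_nhdsWithin] with t ht htI hne
  rcases lt_or_gt_of_ne hne with h | h
  · obtain ⟨c, hc, hc'⟩ := hmv t z htI.1 h hz.2.le
    have := h1 c ⟨ht.1.trans hc.1, hc.2⟩
    rw [hc', lt_div_iff₀ (by linarith)] at this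
    linarith
  · obtain ⟨c, hc, hc'⟩ := hmv z t hz.1.le h htI.2
    have := h2 c ⟨hc.1, hc.2.trans ht.2⟩
    rw [hc', div_lt_iff₀ (by linarith)] at this
    linarith

/-! ### Generic directions and extrema of the height along an edge -/

namespace PiecewiseC2Graph

variable {V E : Type*} (G : PiecewiseC2Graph V E)

theorem hasDerivWithinAt_curve (a : E) : ∀ s ∈ Icc 0 (G.len a),
    HasDerivWithinAt (G.curve a) (G.velocity a s) (Icc 0 (G.len a)) s := fun s hs =>
  ((G.contDiffOn_curve a).differentiableOn two_ne_zero s hs).hasDerivWithinAt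

theorem hasDerivWithinAt_velocity (a : E) : ∀ s ∈ Icc 0 (G.len a),
    HasDerivWithinAt (G.velocity a) (G.curvatureVector a s) (Icc 0 (G.len a)) s := by
  intro s hs
  have h1 : ContDiffOn ℝ 1 (G.velocity a) (Icc 0 (G.len a)) :=
    (G.contDiffOn_curve a).derivWithin (uniqueDiffOn_Icc (G.len_pos a)) (by norm_num)
  have h2 := (h1.differentiableOn one_ne_zero s hs).hasDerivWithinAt
  have h3 : G.curvatureVector a s = derivWithin (G.velocity a) (Icc 0 (G.len a)) s := by
    rw [curvatureVector, iteratedDerivWithin_succ]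
    congr 1
    funext t
    rw [iteratedDerivWithin_one]
    rfl
  rwa [h3]

theorem continuousOn_curvatureVector (a : E) :
    ContinuousOn (G.curvatureVector a) (Icc 0 (G.len a)) :=
  (G.contDiffOn_curve a).continuousOn_iteratedDerivWithin le_rfl
    (uniqueDiffOn_Icc (G.len_pos a))

theorem norm_velocity (a : E) : ∀ s ∈ Icc 0 (G.len a), ‖G.velocity a s‖ = 1 := G.unit_speed a

theorem norm_endTangent (a : E) (b : Bool) : ‖G.endTangent a b‖ = 1 := by
  cases b
  · exact G.norm_velocity a 0 ⟨le_rfl, (G.len_pos a).le⟩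
  · rw [endTangent, norm_neg]
    exact G.norm_velocity a _ ⟨(G.len_pos a).le, le_rfl⟩

/-- The interior local maxima of the height function along an edge, for generic `e`. -/
def heightDescents (e : S2) (a : E) : Set ℝ :=
  descents (fun s => inner ℝ (e : R3) (G.velocity a s))
    (fun s => inner ℝ (e : R3) (G.curvatureVector a s)) (G.len a)

/-- A direction is generic when it is orthogonal to no end tangent and the height functions along
the edges have nondegenerate critical points only. -/
structure IsGeneric (e : S2) : Prop where
  endTangent_ne : ∀ a b, inner ℝ (e : R3) (G.endTangent a b) ≠ 0
  nondegenerate : ∀ a, ∀ s ∈ Icc 0 (G.len a),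
    inner ℝ (e : R3) (G.velocity a s) = 0 → inner ℝ (e : R3) (G.curvatureVector a s) ≠ 0

theorem ae_isGeneric [Finite E] : ∀ᵐ e ∂sphereArea, G.IsGeneric e := by
  have h1 : ∀ᵐ e : S2 ∂sphereArea, ∀ a b, inner ℝ (e : R3) (G.endTangent a b) ≠ 0 := by
    rw [eventually_all]; intro a
    rw [eventually_all]; intro b
    exact ae_inner_ne_zero (G.norm_endTangent a b)
  have h2 : ∀ᵐ e : S2 ∂sphereArea, ∀ a, ∀ s ∈ Icc 0 (G.len a),
      inner ℝ (e : R3) (G.velocity a s) = 0 → inner ℝ (e : R3) (G.curvatureVector a s) ≠ 0 := by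
    rw [eventually_all]; intro a
    exact ae_simple_zeros (G.len_pos a) (G.hasDerivWithinAt_velocity a)
      (G.continuousOn_curvatureVector a) (G.norm_velocity a)
  filter_upwards [h1, h2] with e he1 he2
  exact ⟨he1, he2⟩

/-- The arc length parameter of an end of an edge. -/
def endParam (a : E) : Bool → ℝ
  | false => 0
  | true => G.len a

theorem endParam_mem (a : E) (b : Bool) : G.endParam a b ∈ Icc 0 (G.len a) := by
  cases b
  · exact ⟨le_rfl, (G.len_pos a).le⟩
  · exact ⟨(G.len_pos a).le, le_rfl⟩

theorem doubledEnd_fst (h : (E × Bool) × Bool) : (G.doubledEnd h).1 = h.1 := by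
  rcases h with ⟨d, _ | _⟩ <;> rfl

theorem doubledEnd_snd (h : (E × Bool) × Bool) :
    ((G.doubledEnd h).2 : ℝ) = G.endParam h.1.1 h.2 := by
  rcases h with ⟨d, _ | _⟩ <;> rfl

theorem doubledEnd_injective : Function.Injective G.doubledEnd := by
  intro h k hk
  have h1 : h.1 = k.1 := by rw [← G.doubledEnd_fst, hk, G.doubledEnd_fst]
  have h2 : G.endParam h.1.1 h.2 = G.endParam k.1.1 k.2 := by
    rw [← G.doubledEnd_snd, hk, G.doubledEnd_snd]
  rcases h with ⟨d, _ | _⟩ <;> rcases k with ⟨d', _ | _⟩ <;>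
    simp only [endParam] at h1 h2 <;> subst h1
  · rfl
  · exact absurd h2 (G.len_pos _).ne
  · exact absurd h2 (G.len_pos _).ne'
  · rfl

/-- Here `e` ranges over `R3`, not only the sphere, so that replacing `e` by `-e` transfers
statements on maxima to minima. -/
theorem eventually_height_lt_of_endTangent_neg {a : E} {b : Bool} {e : R3}
    (h : inner ℝ e (G.endTangent a b) < 0) :
    ∀ᶠ t in 𝓝[Icc 0 (G.len a)] (G.endParam a b), t ≠ G.endParam a b →
      inner ℝ e (G.curve a t) < inner ℝ e (G.curve a (G.endParam a b)) := by
  have hder := hasDerivWithinAt_height (G.hasDerivWithinAt_curve a) e _ (G.endParam_mem a b)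
  cases b
  · filter_upwards [eventually_lt_right_of_deriv_neg hder h, eventually_mem_nhdsWithin]
      with t ht1 ht2 hne
    exact ht1 (lt_of_le_of_ne ht2.1 (Ne.symm hne))
  · have hneg : -inner ℝ e (G.velocity a (G.len a)) < 0 := by
      rwa [endTangent, inner_neg_right] at h
    filter_upwards [eventually_gt_left_of_deriv_neg hder.neg hneg, eventually_mem_nhdsWithin]
      with t ht1 ht2 hne
    have := ht1 (lt_of_le_of_ne ht2.2 hne)
    simpa using this

theorem isLocalMaxOn_end_iff {a : E} {b : Bool} {e : R3}
    (hne : inner ℝ e (G.endTangent a b) ≠ 0) :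
    IsLocalMaxOn (fun t => inner ℝ e (G.curve a t)) (Icc 0 (G.len a)) (G.endParam a b) ↔
      inner ℝ e (G.endTangent a b) < 0 := by
  refine ⟨fun h => ?_, fun h =>
    eventually_lt_isLocalMaxOn (G.eventually_height_lt_of_endTangent_neg h)⟩
  by_contra hc
  have hpos : inner ℝ (-e) (G.endTangent a b) < 0 := by
    rw [inner_neg_left, neg_lt_zero]
    exact lt_of_le_of_ne (not_lt.1 hc) hne.symm
  refine eventually_lt_not_isLocalMinOn (G.len_pos a) (G.endParam_mem a b)
    (G.eventually_height_lt_of_endTangent_neg hpos) ?_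
  simpa only [inner_neg_left] using h.neg

theorem isLocalMinOn_iff_isLocalMaxOn_neg (a : E) (e : R3) (s : ℝ) :
    IsLocalMinOn (fun t => inner ℝ e (G.curve a t)) (Icc 0 (G.len a)) s ↔
      IsLocalMaxOn (fun t => inner ℝ (-e) (G.curve a t)) (Icc 0 (G.len a)) s := by
  constructor
  · intro h; simpa only [inner_neg_left] using h.neg
  · intro h; simpa only [inner_neg_left, neg_neg] using h.neg

theorem isLocalMinOn_end_iff {a : E} {b : Bool} {e : R3}
    (hne : inner ℝ e (G.endTangent a b) ≠ 0) :
    IsLocalMinOn (fun t => inner ℝ e (G.curve a t)) (Icc 0 (G.len a)) (G.endParam a b) ↔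
      0 < inner ℝ e (G.endTangent a b) := by
  rw [isLocalMinOn_iff_isLocalMaxOn_neg, G.isLocalMaxOn_end_iff (by simpa using hne),
    inner_neg_left, neg_lt_zero]

theorem isLocalMaxOn_of_mem_heightDescents {e : S2} {a : E} {s : ℝ}
    (hs : s ∈ G.heightDescents e a) :
    IsLocalMaxOn (fun t => inner ℝ (e : R3) (G.curve a t)) (Icc 0 (G.len a)) s ∧
      ¬ IsLocalMinOn (fun t => inner ℝ (e : R3) (G.curve a t)) (Icc 0 (G.len a)) s := by
  have h := eventually_lt_of_second_deriv_neg
    (hasDerivWithinAt_height (G.hasDerivWithinAt_curve a) e)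
    (hasDerivWithinAt_height (G.hasDerivWithinAt_velocity a) e) hs.1 hs.2.1 hs.2.2
  exact ⟨eventually_lt_isLocalMaxOn h,
    eventually_lt_not_isLocalMinOn (G.len_pos a) (Ioo_subset_Icc_self hs.1) h⟩

theorem not_isLocalMaxOn_of_second_deriv_pos {e : R3} {a : E} {s : ℝ} (hs : s ∈ Ioo 0 (G.len a))
    (h0 : inner ℝ e (G.velocity a s) = 0) (h1 : 0 < inner ℝ e (G.curvatureVector a s)) :
    ¬ IsLocalMaxOn (fun t => inner ℝ e (G.curve a t)) (Icc 0 (G.len a)) s := by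
  have h := eventually_lt_of_second_deriv_neg
    (hasDerivWithinAt_height (G.hasDerivWithinAt_curve a) (-e))
    (hasDerivWithinAt_height (G.hasDerivWithinAt_velocity a) (-e)) hs
    (by rw [inner_neg_left, h0, neg_zero]) (by rwa [inner_neg_left, neg_lt_zero])
  intro hmax
  refine eventually_lt_not_isLocalMinOn (G.len_pos a) (Ioo_subset_Icc_self hs) h ?_
  simpa only [inner_neg_left] using hmax.neg

theorem exists_doubledEnd_of_doubledMap_eq_pos {x : G.DoubledEdges} {v : V}
    (hx : G.doubledMap x = G.pos v) :
    ∃ h, x = G.doubledEnd h ∧ G.endVertex h.1.1 h.2 = v := by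
  obtain ⟨d, s, hs⟩ := x
  have key : ∀ b, s = G.endParam d.1 b →
      ∃ h, (⟨d, s, hs⟩ : G.DoubledEdges) = G.doubledEnd h ∧ G.endVertex h.1.1 h.2 = v := by
    rintro b rfl
    refine ⟨(d, b), by cases b <;> rfl, G.pos_injective ?_⟩
    rw [← hx, ← G.doubledMap_doubledEnd (d, b)]
    cases b <;> rfl
  rcases hs.1.eq_or_lt with h0 | h0
  · exact key false h0.symm
  rcases hs.2.eq_or_lt with h1 | h1
  · exact key true h1
  · exact absurd hx (G.interior_ne_vertex d.1 s ⟨h0, h1⟩ v)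

theorem exists_eq_of_doubledMap_eq_interior {x : G.DoubledEdges} {a : E} {s : ℝ}
    (hs : s ∈ Ioo 0 (G.len a)) (hx : G.doubledMap x = G.curve a s) :
    ∃ i, x = ⟨(a, i), s, Ioo_subset_Icc_self hs⟩ := by
  obtain ⟨⟨a', i⟩, t, ht⟩ := x
  change G.curve a' t = G.curve a s at hx
  have h0 : t ≠ 0 := by
    rintro rfl
    rw [G.curve_zero] at hx
    exact G.interior_ne_vertex a s hs _ hx.symm
  have h1 : t ≠ G.len a' := by
    rintro rfl
    rw [G.curve_len] at hx
    exact G.interior_ne_vertex a s hs _ hx.symm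
  have ht' : t ∈ Ioo 0 (G.len a') := ⟨lt_of_le_of_ne ht.1 h0.symm, lt_of_le_of_ne ht.2 h1⟩
  have haa : a' = a := by
    by_contra hne
    exact G.interior_disjoint a' a hne t ht' s hs hx
  subst haa
  have := G.injOn_curve a' ht (Ioo_subset_Icc_self hs) hx
  subst this
  exact ⟨i, rfl⟩

/-! ### Local extrema on the glued manifold and net local maxima -/

namespace Parameterization

variable {G} (P : G.Parameterization)

/-- The point of the parameterizing manifold given by a point of a doubled edge. -/
def proj (x : G.DoubledEdges) : P.Domain := Quot.mk P.Glue x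

theorem toSpace_proj (x : G.DoubledEdges) : P.toSpace (P.proj x) = G.doubledMap x := rfl

theorem exists_proj_eq (x : P.Domain) : ∃ y, P.proj y = x := Quot.exists_rep x

theorem isQuotientMap_proj : IsQuotientMap P.proj := isQuotientMap_quot_mk

/-- Since `mate` is an involution and `doubledEnd` is injective, `Glue` is symmetric and two
successive gluings return to the start; no further identifications are generated. -/
theorem proj_eq_proj {x y : G.DoubledEdges} : P.proj x = P.proj y ↔ x = y ∨ P.Glue x y := by
  constructor
  · intro h
    have hgen := Quot.eqvGen_exact h
    clear h
    induction hgen with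
    | rel x y h => exact Or.inr h
    | refl x => exact Or.inl rfl
    | symm x y _ ih =>
      rcases ih with rfl | ⟨h, rfl, rfl⟩
      · exact Or.inl rfl
      · exact Or.inr ⟨P.mate h, rfl, by rw [P.mate_involutive]⟩
    | trans x y z _ _ ih1 ih2 =>
      rcases ih1 with rfl | ⟨h, rfl, rfl⟩
      · exact ih2
      · rcases ih2 with rfl | ⟨k, hk, rfl⟩
        · exact Or.inr ⟨h, rfl, rfl⟩
        · rw [← G.doubledEnd_injective hk, P.mate_involutive]
          exact Or.inl rfl
  · rintro (rfl | h)
    · rfl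
    · exact Quot.sound h

theorem proj_doubledEnd_eq_iff {h : (E × Bool) × Bool} {y : G.DoubledEdges} :
    P.proj y = P.proj (G.doubledEnd h) ↔ y = G.doubledEnd h ∨ y = G.doubledEnd (P.mate h) := by
  rw [proj_eq_proj]
  refine or_congr_right ⟨?_, ?_⟩
  · rintro ⟨k, rfl, hk⟩
    rw [G.doubledEnd_injective hk, P.mate_involutive]
  · rintro rfl
    exact ⟨P.mate h, rfl, by rw [P.mate_involutive]⟩

theorem proj_interior_eq_iff {a : E} {i : Bool} {s : ℝ} (hs : s ∈ Ioo 0 (G.len a))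
    {y : G.DoubledEdges} :
    P.proj y = P.proj ⟨(a, i), s, Ioo_subset_Icc_self hs⟩ ↔
      y = ⟨(a, i), s, Ioo_subset_Icc_self hs⟩ := by
  rw [proj_eq_proj, or_iff_left]
  rintro ⟨h, -, hk⟩
  have h1 := congrArg G.doubledMap hk
  rw [G.doubledMap_doubledEnd] at h1
  exact G.interior_ne_vertex a s hs _ h1

/-- This reduces local extrema on the quotient to extrema on each closed edge through the point. -/
theorem eventually_nhds_proj_iff [Finite E] {p : P.Domain → Prop} {x : G.DoubledEdges} :
    (∀ᶠ y in 𝓝 (P.proj x), p y) ↔ ∀ x', P.proj x' = P.proj x → ∀ᶠ z in 𝓝 x', p (P.proj z) := by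
  constructor
  · intro h x' hx'
    rw [← hx'] at h
    exact P.isQuotientMap_proj.continuous.continuousAt.eventually h
  · intro h
    -- Removing the finitely many ends not lying over `proj x` keeps the set open and makes it
    -- saturated: an end that remains lies over `proj x`, and by `h` its mate belongs to the set
    -- too.
    set O : Set G.DoubledEdges :=
      interior {z | p (P.proj z)} \ {z ∈ range G.doubledEnd | P.proj z ≠ P.proj x} with hO
    have hfin : {z ∈ range G.doubledEnd | P.proj z ≠ P.proj x}.Finite :=
      (finite_range _).subset fun z hz => hz.1
    have hopen : IsOpen O := isOpen_interior.sdiff hfin.isClosed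
    have hsat : P.proj ⁻¹' (P.proj '' O) = O := by
      refine subset_antisymm ?_ (subset_preimage_image _ _)
      rintro z ⟨w, hw, hwz⟩
      rcases P.proj_eq_proj.1 hwz with rfl | ⟨k, rfl, rfl⟩
      · exact hw
      · have hwx : P.proj (G.doubledEnd k) = P.proj x := by
          by_contra hc
          exact hw.2 ⟨⟨k, rfl⟩, hc⟩
        have hzx := hwz.symm.trans hwx
        exact ⟨mem_interior_iff_mem_nhds.2 (h _ hzx), fun hc => hc.2 hzx⟩
    have hopen' : IsOpen (P.proj '' O) := by
      rw [← P.isQuotientMap_proj.isOpen_preimage, hsat]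
      exact hopen
    have hxO : x ∈ O := ⟨mem_interior_iff_mem_nhds.2 (h x rfl), fun hc => hc.2 rfl⟩
    filter_upwards [hopen'.mem_nhds ⟨x, hxO, rfl⟩] with y hy
    obtain ⟨z, hz, rfl⟩ := hy
    have hz' : z ∈ {z | p (P.proj z)} := interior_subset hz.1
    exact hz'

theorem eventually_nhds_doubledEdges_iff {p : R3 → Prop} {x : G.DoubledEdges} :
    (∀ᶠ z in 𝓝 x, p (G.doubledMap z)) ↔
      ∀ᶠ t in 𝓝[Icc 0 (G.len x.1.1)] (x.2 : ℝ), p (G.curve x.1.1 t) := by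
  obtain ⟨d, s⟩ := x
  rw [Sigma.nhds_mk, eventually_map, ← map_nhds_subtype_val, eventually_map]
  rfl

theorem isLocalMax_height_proj_iff [Finite E] {e : S2} {x : G.DoubledEdges} :
    IsLocalMax (P.height e) (P.proj x) ↔ ∀ x', P.proj x' = P.proj x →
      IsLocalMaxOn (fun t => inner ℝ (e : R3) (G.curve x'.1.1 t)) (Icc 0 (G.len x'.1.1)) x'.2 := by
  rw [IsLocalMax, IsMaxFilter, eventually_nhds_proj_iff]
  refine forall₂_congr fun x' hx' => ?_
  rw [← hx']
  exact eventually_nhds_doubledEdges_iff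
    (p := fun q => inner ℝ (e : R3) q ≤ inner ℝ (e : R3) (G.doubledMap x'))

theorem isLocalMin_height_proj_iff [Finite E] {e : S2} {x : G.DoubledEdges} :
    IsLocalMin (P.height e) (P.proj x) ↔ ∀ x', P.proj x' = P.proj x →
      IsLocalMinOn (fun t => inner ℝ (e : R3) (G.curve x'.1.1 t)) (Icc 0 (G.len x'.1.1)) x'.2 := by
  rw [IsLocalMin, IsMinFilter, eventually_nhds_proj_iff]
  refine forall₂_congr fun x' hx' => ?_
  rw [← hx']
  exact eventually_nhds_doubledEdges_iff
    (p := fun q => inner ℝ (e : R3) (G.doubledMap x') ≤ inner ℝ (e : R3) q)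

/-- The derivative of the height at an end of a doubled edge, in the direction into the edge. -/
def endSlope (G : PiecewiseC2Graph V E) (e : S2) (h : (E × Bool) × Bool) : ℝ :=
  inner ℝ (e : R3) (G.endTangent h.1.1 h.2)

theorem isLocalMax_height_end_iff [Finite E] {e : S2} (he : G.IsGeneric e)
    (h : (E × Bool) × Bool) :
    IsLocalMax (P.height e) (P.proj (G.doubledEnd h)) ↔
      endSlope G e h < 0 ∧ endSlope G e (P.mate h) < 0 := by
  simp only [isLocalMax_height_proj_iff, proj_doubledEnd_eq_iff, forall_eq_or_imp, forall_eq]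
  rw [G.doubledEnd_snd, G.doubledEnd_snd, G.doubledEnd_fst, G.doubledEnd_fst,
    G.isLocalMaxOn_end_iff (he.endTangent_ne _ _), G.isLocalMaxOn_end_iff (he.endTangent_ne _ _)]
  rfl

theorem isLocalMin_height_end_iff [Finite E] {e : S2} (he : G.IsGeneric e)
    (h : (E × Bool) × Bool) :
    IsLocalMin (P.height e) (P.proj (G.doubledEnd h)) ↔
      0 < endSlope G e h ∧ 0 < endSlope G e (P.mate h) := by
  simp only [isLocalMin_height_proj_iff, proj_doubledEnd_eq_iff, forall_eq_or_imp, forall_eq]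
  rw [G.doubledEnd_snd, G.doubledEnd_snd, G.doubledEnd_fst, G.doubledEnd_fst,
    G.isLocalMinOn_end_iff (he.endTangent_ne _ _), G.isLocalMinOn_end_iff (he.endTangent_ne _ _)]
  rfl

open Classical in
/-- The points of the parameterizing manifold over a vertex at which some property holds are
counted by the ends of doubled edges, each such point being the image of two of them. -/
theorem two_mul_ncard_over_vertex [Fintype E] (v : V) {p : P.Domain → Prop}
    {q : (E × Bool) × Bool → Prop} (hpq : ∀ h, p (P.proj (G.doubledEnd h)) ↔ q h ∧ q (P.mate h)) :
    2 * ({x | P.toSpace x = G.pos v ∧ p x}.ncard : ℝ) =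
      ∑ h, if G.endVertex h.1.1 h.2 = v ∧ q h ∧ q (P.mate h) then 1 else 0 := by
  set H := (Finset.univ : Finset ((E × Bool) × Bool)).filter
    fun h => G.endVertex h.1.1 h.2 = v ∧ q h ∧ q (P.mate h) with hH
  set F : (E × Bool) × Bool → P.Domain := fun h => P.proj (G.doubledEnd h) with hF
  have himg : {x | P.toSpace x = G.pos v ∧ p x} = (H.image F : Finset P.Domain) := by
    ext x
    simp only [mem_ofPred_eq, Finset.coe_image, mem_image, Finset.mem_coe, hH, Finset.mem_filter,
      Finset.mem_univ, true_and, hF]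
    constructor
    · rintro ⟨hx, hpx⟩
      obtain ⟨y, rfl⟩ := P.exists_proj_eq x
      obtain ⟨h, rfl, hv⟩ := G.exists_doubledEnd_of_doubledMap_eq_pos hx
      exact ⟨h, ⟨hv, (hpq h).1 hpx⟩, rfl⟩
    · rintro ⟨h, ⟨hv, hq⟩, rfl⟩
      exact ⟨by rw [toSpace_proj, doubledMap_doubledEnd, hv], (hpq h).2 hq⟩
  have hcard : H.card = 2 * (H.image F).card := by
    rw [Finset.card_eq_sum_card_image F H, mul_comm, ← smul_eq_mul, ← Finset.sum_const]
    refine Finset.sum_congr rfl fun x hx => ?_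
    obtain ⟨h, hh, rfl⟩ := Finset.mem_image.1 hx
    -- The condition defining `H` is symmetric under `mate`, so each fibre is a full pair, with two
    -- elements by `mate_ne`.
    have : H.filter (fun k => F k = F h) = {h, P.mate h} := by
      ext k
      simp only [Finset.mem_filter, Finset.mem_insert, Finset.mem_singleton, hF,
        proj_doubledEnd_eq_iff, G.doubledEnd_injective.eq_iff]
      refine and_iff_right_of_imp ?_
      rintro (rfl | rfl)
      · exact hh
      · simp only [hH, Finset.mem_filter, Finset.mem_univ, true_and, P.mate_involutive h,
          P.endVertex_mate] at hh ⊢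
        exact ⟨hh.1, hh.2.2, hh.2.1⟩
    rw [this, Finset.card_pair (P.mate_ne h).symm]
  rw [himg, ncard_coe_finset, ← Nat.cast_ofNat, ← Nat.cast_mul, ← hcard, hH, Finset.card_filter]
  push_cast
  rfl

open Classical in
/-- The number of net local maxima at a vertex does not depend on the parameterization. -/
theorem nlm_vertex [Fintype E] {e : S2} (he : G.IsGeneric e) (v : V) :
    P.nlm e (G.pos v) = (1 / 2) * ∑ h : E × Bool with G.endVertex h.1 h.2 = v,
      hemisphereSign (G.endTangent h.1 h.2) e := by
  have hmax := P.two_mul_ncard_over_vertex v (p := IsLocalMax (P.height e))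
    (q := fun h => endSlope G e h < 0) (P.isLocalMax_height_end_iff he)
  have hmin := P.two_mul_ncard_over_vertex v (p := IsLocalMin (P.height e))
    (q := fun h => 0 < endSlope G e h) (P.isLocalMin_height_end_iff he)
  set χ : (E × Bool) × Bool → ℝ := fun h =>
    if G.endVertex h.1.1 h.2 = v then hemisphereSign (G.endTangent h.1.1 h.2) e else 0 with hχ
  have hmate : ∑ h, χ (P.mate h) = ∑ h, χ h :=
    Equiv.sum_comp (Function.Involutive.toPerm _ P.mate_involutive) χ
  have hdiff : 2 * (P.lmax e (G.pos v) : ℝ) - 2 * (P.lmin e (G.pos v) : ℝ) = ∑ h, χ h := by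
    rw [lmax, lmin, hmax, hmin, ← Finset.sum_sub_distrib]
    -- After averaging over mates the identity holds term by term: the mean of two signs is `1`,
    -- `-1` or `0` at a maximum, a minimum or neither.
    have : ∑ h, χ h = ∑ h, (χ h + χ (P.mate h)) / 2 := by
      rw [← Finset.sum_div, Finset.sum_add_distrib, hmate]; ring
    rw [this]
    refine Finset.sum_congr rfl fun h _ => ?_
    simp only [hχ, P.endVertex_mate]
    by_cases hv : G.endVertex h.1.1 h.2 = v
    · have h1 := he.endTangent_ne h.1.1 h.2
      have h2 := he.endTangent_ne (P.mate h).1.1 (P.mate h).2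
      simp only [hv, true_and, if_true, endSlope, hemisphereSign]
      rcases lt_or_gt_of_ne h1 with h1 | h1 <;> rcases lt_or_gt_of_ne h2 with h2 | h2 <;>
        simp [h1, h2, h1.not_gt, h2.not_gt]
    · simp [hv]
  -- Both copies of an edge have the same tangents at their ends.
  have hdouble : ∑ h, χ h = 2 * ∑ h : E × Bool with G.endVertex h.1 h.2 = v,
      hemisphereSign (G.endTangent h.1 h.2) e := by
    rw [Finset.sum_filter, Fintype.sum_prod_type, Fintype.sum_prod_type, Fintype.sum_prod_type,
      Finset.mul_sum]
    refine Finset.sum_congr rfl fun a _ => ?_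
    simp only [hχ, Fintype.sum_bool]
    ring
  rw [nlm]
  linarith

/-- At a nondegenerate local maximum of the height in the interior of an edge, there is one net
local maximum. -/
theorem nlm_of_mem_heightDescents [Finite E] {e : S2} {a : E} {s : ℝ}
    (hs : s ∈ G.heightDescents e a) : P.nlm e (G.curve a s) = 1 := by
  have hI := hs.1
  have h1 := G.isLocalMaxOn_of_mem_heightDescents hs
  -- One point for each copy of the edge, so `nlm = (1 / 2) * (2 - 0)`.
  have hmax : {x | P.toSpace x = G.curve a s ∧ IsLocalMax (P.height e) x} =
      {P.proj ⟨(a, false), s, Ioo_subset_Icc_self hI⟩,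
        P.proj ⟨(a, true), s, Ioo_subset_Icc_self hI⟩} := by
    ext x
    simp only [mem_ofPred_eq, mem_insert_iff, mem_singleton_iff]
    constructor
    · rintro ⟨hx, -⟩
      obtain ⟨y, rfl⟩ := P.exists_proj_eq x
      obtain ⟨i, rfl⟩ := G.exists_eq_of_doubledMap_eq_interior hI hx
      cases i
      · exact Or.inl rfl
      · exact Or.inr rfl
    · rintro (rfl | rfl)
      all_goals
        refine ⟨rfl, ?_⟩
        rw [isLocalMax_height_proj_iff]
        intro x' hx'
        rw [P.proj_interior_eq_iff hI] at hx'
        subst hx'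
        exact h1.1
  have hmin : {x | P.toSpace x = G.curve a s ∧ IsLocalMin (P.height e) x} = ∅ := by
    rw [eq_empty_iff_forall_notMem]
    rintro x ⟨hx, hx'⟩
    obtain ⟨y, rfl⟩ := P.exists_proj_eq x
    obtain ⟨i, rfl⟩ := G.exists_eq_of_doubledMap_eq_interior hI hx
    exact h1.2 (P.isLocalMin_height_proj_iff.1 hx' _ rfl)
  have hne : P.proj ⟨(a, false), s, Ioo_subset_Icc_self hI⟩ ≠
      P.proj ⟨(a, true), s, Ioo_subset_Icc_self hI⟩ := by
    rw [Ne, P.proj_interior_eq_iff hI]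
    intro h
    have := congrArg (fun x => x.1.2) h
    simp at this
  rw [nlm, lmax, lmin, hmax, hmin, ncard_pair hne]
  simp

theorem nlm_nonpos_of_second_deriv_pos [Finite E] {e : S2} {a : E} {s : ℝ}
    (hs : s ∈ Ioo 0 (G.len a)) (h0 : inner ℝ (e : R3) (G.velocity a s) = 0)
    (h1 : 0 < inner ℝ (e : R3) (G.curvatureVector a s)) : P.nlm e (G.curve a s) ≤ 0 := by
  have hmax : {x | P.toSpace x = G.curve a s ∧ IsLocalMax (P.height e) x} = ∅ := by
    rw [eq_empty_iff_forall_notMem]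
    rintro x ⟨hx, hx'⟩
    obtain ⟨y, rfl⟩ := P.exists_proj_eq x
    obtain ⟨i, rfl⟩ := G.exists_eq_of_doubledMap_eq_interior hs hx
    exact G.not_isLocalMaxOn_of_second_deriv_pos hs h0 h1 (P.isLocalMax_height_proj_iff.1 hx' _ rfl)
  rw [nlm, lmax, hmax]
  simp

end Parameterization

/-! ### The multiplicity in a generic direction -/

/-- The interior critical points of the height along an edge, by arc length. -/
def edgeCriticalParams (e : S2) (a : E) : Set ℝ :=
  {s ∈ Ioo 0 (G.len a) | inner ℝ (e : R3) (G.velocity a s) = 0}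

theorem criticalPoints_eq (e : S2) :
    G.criticalPoints e = range G.pos ∪ ⋃ a, G.curve a '' G.edgeCriticalParams e a := by
  rw [criticalPoints]
  congr 1
  ext q
  simp only [mem_ofPred_eq, mem_iUnion, mem_image, edgeCriticalParams]
  refine exists_congr fun a => exists_congr fun s => ?_
  tauto

variable {G}

theorem IsGeneric.finite_edgeCriticalParams {e : S2} (he : G.IsGeneric e) (a : E) :
    (G.edgeCriticalParams e a).Finite :=
  (finite_zeros_of_simple (hasDerivWithinAt_height (G.hasDerivWithinAt_velocity a) (e : R3))
    (he.nondegenerate a)).subset fun _ h => ⟨Ioo_subset_Icc_self h.1, h.2⟩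

theorem IsGeneric.finite_criticalPoints [Finite V] [Finite E] {e : S2} (he : G.IsGeneric e) :
    (G.criticalPoints e).Finite := by
  rw [criticalPoints_eq]
  exact (finite_range _).union (finite_iUnion fun a => (he.finite_edgeCriticalParams a).image _)

/-- By nondegeneracy every critical point is a maximum, counted once, or a minimum, which the
positive part discards. Injectivity of the edge lets the sum run over parameters. -/
theorem Parameterization.finsum_edge (P : G.Parameterization) [Finite E] {e : S2}
    (he : G.IsGeneric e) (a : E) :
    ∑ᶠ q ∈ G.curve a '' G.edgeCriticalParams e a, max (P.nlm e q) 0 =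
      (G.heightDescents e a).ncard := by
  classical
  have hfin := he.finite_edgeCriticalParams a
  rw [finsum_mem_image ((G.injOn_curve a).mono fun s hs => Ioo_subset_Icc_self hs.1),
    finsum_mem_eq_finite_toFinset_sum _ hfin]
  have hterm : ∀ s ∈ hfin.toFinset, max (P.nlm e (G.curve a s)) 0 =
      if s ∈ G.heightDescents e a then 1 else 0 := by
    intro s hs
    rw [Finite.mem_toFinset] at hs
    split_ifs with h
    · rw [P.nlm_of_mem_heightDescents h]; simp
    · have hne := he.nondegenerate a s (Ioo_subset_Icc_self hs.1) hs.2
      have hpos : 0 < inner ℝ (e : R3) (G.curvatureVector a s) := by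
        refine lt_of_le_of_ne (not_lt.1 fun hc => h ⟨hs.1, hs.2, hc⟩) hne.symm
      exact max_eq_right (P.nlm_nonpos_of_second_deriv_pos hs.1 hs.2 hpos)
  rw [Finset.sum_congr rfl hterm, Finset.sum_boole]
  congr 1
  rw [← ncard_coe_finset]
  congr 1
  ext s
  simp only [Finset.coe_filter, Finite.mem_toFinset, mem_ofPred_eq]
  exact and_iff_right_of_imp fun h => ⟨h.1, h.2.1⟩

open Classical in
theorem Parameterization.multiplicity_eq (P : G.Parameterization) [Fintype V] [Fintype E]
    {e : S2} (he : G.IsGeneric e) :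
    P.multiplicity e = ∑ v, (1 / 2) * max (∑ h : E × Bool with G.endVertex h.1 h.2 = v,
      hemisphereSign (G.endTangent h.1 h.2) e) 0 + ∑ a, ((G.heightDescents e a).ncard : ℝ) := by
  have hfin : ∀ a, (G.curve a '' G.edgeCriticalParams e a).Finite := fun a =>
    (he.finite_edgeCriticalParams a).image _
  have hdisj : Disjoint (range G.pos) (⋃ a, G.curve a '' G.edgeCriticalParams e a) := by
    rw [disjoint_left]
    rintro _ ⟨v, rfl⟩ h
    obtain ⟨a, s, hs, hs'⟩ := mem_iUnion.1 h
    exact G.interior_ne_vertex a s hs.1 v hs'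
  have hpair : Pairwise (Function.onFun Disjoint
      fun a => G.curve a '' G.edgeCriticalParams e a) := by
    intro a b hab
    rw [Function.onFun, disjoint_left]
    rintro _ ⟨s, hs, rfl⟩ ⟨t, ht, hst⟩
    exact G.interior_disjoint a b hab s hs.1 t ht.1 hst.symm
  rw [multiplicity, criticalPoints_eq, finsum_mem_union hdisj (finite_range _)
    (finite_iUnion hfin), finsum_mem_range G.pos_injective, finsum_eq_sum_of_fintype,
    finsum_mem_iUnion hpair hfin, finsum_eq_sum_of_fintype]
  congr 1
  · refine Finset.sum_congr rfl fun v _ => ?_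
    rw [P.nlm_vertex he, mul_max_of_nonneg _ _ (by norm_num : (0 : ℝ) ≤ 1 / 2), mul_zero]
  · exact Finset.sum_congr rfl fun a _ => P.finsum_edge he a

theorem measurable_hemisphereSign (T : R3) : Measurable (hemisphereSign T) :=
  Measurable.ite (measurableSet_lt measurable_const (measurable_inner_sphere T))
    measurable_const measurable_const

theorem integrable_hemisphereSign (T : R3) : Integrable (hemisphereSign T) sphereArea := by
  refine Integrable.of_bound (measurable_hemisphereSign T).aestronglyMeasurable 1
    (Eventually.of_forall fun e => ?_)
  rw [hemisphereSign]
  split_ifs <;> simp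

end PiecewiseC2Graph

end

/-! ### Integration over the sphere -/

/-- For a piecewise `C²` graph and any parameterization of its double, the multiplicity is a
well-defined finite sum for almost every direction, it is integrable, and the net total curvature
is half of its integral over the sphere. -/
theorem theorem1 {V E : Type*} [Fintype V] [Fintype E] (G : PiecewiseC2Graph V E)
    (P : G.Parameterization) :
    (∀ᵐ e ∂sphereArea, (G.criticalPoints e).Finite) ∧
      Integrable P.multiplicity sphereArea ∧
      G.netTotalCurvature = (1 / 2) * ∫ e, P.multiplicity e ∂sphereArea := by
  classical
  have hgen := G.ae_isGeneric
  have hvert : ∀ v, Integrable (fun e => (1 / 2) *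
      max (∑ h : E × Bool with G.endVertex h.1 h.2 = v,
        PiecewiseC2Graph.hemisphereSign (G.endTangent h.1 h.2) e) 0) sphereArea := fun v =>
    ((integrable_finsetSum _ fun h _ =>
      PiecewiseC2Graph.integrable_hemisphereSign _).pos_part).const_mul _
  have hedge : ∀ a, Integrable (fun e => ((G.heightDescents e a).ncard : ℝ)) sphereArea := fun a =>
    integrable_ncard_descents (G.len_pos a) (G.hasDerivWithinAt_velocity a)
      (G.continuousOn_curvatureVector a) (G.norm_velocity a)
  have hmul : P.multiplicity =ᵐ[sphereArea] fun e =>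
      ∑ v, (1 / 2) * max (∑ h : E × Bool with G.endVertex h.1 h.2 = v,
        PiecewiseC2Graph.hemisphereSign (G.endTangent h.1 h.2) e) 0 +
      ∑ a, ((G.heightDescents e a).ncard : ℝ) := by
    filter_upwards [hgen] with e he
    convert P.multiplicity_eq he
  have hsumv := integrable_finsetSum Finset.univ fun v _ => hvert v
  have hsume := integrable_finsetSum Finset.univ fun a _ => hedge a
  refine ⟨hgen.mono fun e he => he.finite_criticalPoints, (hsumv.add hsume).congr hmul.symm, ?_⟩
  rw [integral_congr_ae hmul, integral_add hsumv hsume, integral_finsetSum _ fun v _ => hvert v,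
    integral_finsetSum _ fun a _ => hedge a, PiecewiseC2Graph.netTotalCurvature, mul_add,
    Finset.mul_sum, Finset.mul_sum]
  congr 1
  · refine Finset.sum_congr rfl fun v _ => ?_
    rw [PiecewiseC2Graph.vertexNetCurvature, integral_const_mul, ← mul_assoc]
    norm_num
  · refine Finset.sum_congr rfl fun a _ => ?_
    -- Crofton's formula for the unit tangent, whose speed is the curvature; its factor `2` cancels
    -- the `1 / 2`.
    have := integral_ncard_descents (G.len_pos a) (G.hasDerivWithinAt_velocity a)
      (G.continuousOn_curvatureVector a) (G.norm_velocity a)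
    simp only [PiecewiseC2Graph.heightDescents]
    rw [this]
    ring
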